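/- Let $S$ be a measurable state space, $A$ a finite non-empty action set, $p(\cdot\mid s,a)$ a Markov transition kernel, $\gamma\in[0,1)$, $s_0\in S$ a fixed initial state and $\tau\in(0,1/(1-\gamma)]$. Let $\phi:S\times A\times S\to\mathbb R^d$ be bounded, $\phi_{\max}=\sup_{s,a,s'}\lVert\phi(s,a,s')\rVert$ (Euclidean norm). Policies are stationary, measurable and possibly stochastic. For a bounded measurable function $f(s,a,s')$ let $Q_f^\pi(s,a)=\mathbb E_\pi[\sum_{t\ge0}\gamma^t f(s_t,a_t,s_{t+1})\mid s_0=s,a_0=a]$ and $V_f^\pi(s)=\mathbb E_{a\sim\pi(s)}Q_f^\pi(s,a)$. Consider $N\ge1$ source tasks $M_1,\dots,M_N$ and a target task $M_j$. Each task $M_k$ has a bounded measurable reward $r_k=\phi^\top w_{r,k}$ and a measurable utility $c_k=\phi^\top w_{c,k}$ with values in $[0,1]$. Write $V_{r,k}^\pi,V_{c,k}^\pi,Q_{r,k}^\pi,Q_{c,k}^\pi$ for the corresponding value functions of $\pi$ in $M_k$. An optimal policy of $M_k$ is a policy that maximizes $V_{r,k}^\pi(s_0)$ among the policies with $V_{c,k}^\pi(s_0)\ge\tau$.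 Put $L_{k,\lambda}^\pi(s)=V_{r,k}^\pi(s)+\lambda(V_{c,k}^\pi(s)-\tau)$ and $Q_{k,\lambda}^\pi(s,a)=Q_{r,k}^\pi(s,a)+\lambda(Q_{c,k}^\pi(s,a)-\tau)$, and let $\lambda_k^*\ge0$ be an optimal dual variable, i.e. a minimizer over $\lambda\ge0$ of $\sup_\pi L_{k,\lambda}^\pi(s_0)$. Assume that Slater's condition, in the weak form that some policy $\bar\pi$ has $V_{c,k}^{\bar\pi}(s_0)\ge\tau$, holds for every one of these tasks. Then an optimal policy of $M_j$ exists, and every source task $M_i$ has an optimal policy $\pi_i^*$ with the following property: (P) for all $s,a$, and for almost every $s'$ with respect to the part of $p(\cdot\mid s,a)$ that is singular to the occupancy measure $\sum_t\gamma^t\,\mathbb P_{\pi_i^*}(s_t\in\cdot\mid s_0)$, the policy $\pi_i^*$ maximizes $\pi\mapsto L_{i,\lambda_i^*}^{\pi}(s')$. (If $S$ is countable and $\gamma>0$, this is only required at the successors $s'$ of $(s,a)$ that $\pi_i^*$ visits from $s_0$ with probability $0$.) Moreover, let $\pi_i^*$ be any optimal policies of the source tasks with property (P), and let $\pi_j^*$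 be any optimal policy of $M_j$. Let $\tilde Q_{r,j}^{\pi_i},\tilde Q_{c,j}^{\pi_i}$ satisfy $|Q_{r,j}^{\pi_i^*}(s,a)-\tilde Q_{r,j}^{\pi_i}(s,a)|\le\epsilon$ and $|Q_{c,j}^{\pi_i^*}(s,a)-\tilde Q_{c,j}^{\pi_i}(s,a)|\le\epsilon$ for all $s,a$ and $i\in\{1,\dots,N\}$, let $\tilde\lambda_j\ge0$, and let $\pi$ be a policy with $\pi(s)\in\arg\max_a\max_{i}\{\tilde Q_{r,j}^{\pi_i}(s,a)+\tilde\lambda_j\tilde Q_{c,j}^{\pi_i}(s,a)\}$ for every $s$ (if $\pi$ is stochastic: $\pi(s)$ is supported on this set). Then for all $s,a$ $$Q_{j,\lambda_j^*}^{\pi_j^*}(s,a)-Q_{j,\tilde\lambda_j}^{\pi}(s,a)\le\min_{1\le i\le N}\Big[\frac{2}{1-\gamma}\Big(\phi_{\max}\lVert w_{r,j}-w_{r,i}\rVert+\phi_{\max}\lVert\lambda_j^*w_{c,j}-\lambda_i^*w_{c,i}\rVert+|\lambda_j^*-\tilde\lambda_j|+\epsilon(1+\tilde\lambda_j)\Big)+2\tau|\lambda_j^*-\lambda_i^*|\Big].$$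 -/

import Mathlib

open MeasureTheory ProbabilityTheory

noncomputable section

/-- The environment shared by all tasks: a controlled Markov transition kernel `p(· | s, a)` on a
measurable state space and a discount factor `γ ∈ [0, 1)`. -/
structure Environment (S A : Type*) [MeasurableSpace S] [MeasurableSpace A] where
  transition : Kernel (S × A) S
  markov : IsMarkovKernel transition
  discount : ℝ
  discount_nonneg : 0 ≤ discount
  discount_lt_one : discount < 1

attribute [instance] Environment.markov

/-- A stationary stochastic policy: a Markov kernel from states to actions. -/
structure Policy (S A : Type*) [MeasurableSpace S] [MeasurableSpace A] where
  kernel : Kernel S A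
  markov : IsMarkovKernel kernel

attribute [instance] Policy.markov

section Definitions

variable {S A : Type*} [MeasurableSpace S] [MeasurableSpace A]

namespace Environment

variable (E : Environment S A) (π : Policy S A)

/-- One step of the state-action chain: `s' ∼ p(· | s, a)`, then `a' ∼ π(· | s')`. -/
def step : Kernel (S × A) (S × A) :=
  E.transition.compProd (π.kernel.prodMkLeft (S × A))

instance step_markov : IsMarkovKernel (E.step π) := by
  unfold step; infer_instance

/-- The conditional law of `(s_{n+1}, a_{n+1})` given the history up to time `n`. -/
def historyStep (n : ℕ) : Kernel ((_ : Finset.Iic n) → S × A) (S × A) :=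
  (E.step π).comap (fun h => h ⟨n, Finset.mem_Iic.2 le_rfl⟩) (measurable_pi_apply _)

instance historyStep_markov (n : ℕ) : IsMarkovKernel (E.historyStep π n) := by
  unfold historyStep; infer_instance

/-- The law of the infinite trajectory `(s_t, a_t)_{t ≥ 0}` generated by `π` in the environment,
given the initial pair `(s_0, a_0)`. -/
def trajectory : Kernel (S × A) (ℕ → S × A) :=
  (Kernel.traj (X := fun _ => S × A) (E.historyStep π) 0).comap
    (fun x _ => x) (measurable_pi_lambda _ fun _ => measurable_id)

instance trajectory_markov : IsMarkovKernel (E.trajectory π) := by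
  unfold trajectory; infer_instance

/-- The discounted return `∑_t γ^t f(s_t, a_t, s_{t+1})` of a trajectory. -/
def discountedReturn (f : S → A → S → ℝ) (x : ℕ → S × A) : ℝ :=
  ∑' t : ℕ, E.discount ^ t * f (x t).1 (x t).2 (x (t + 1)).1

/-- The action-value function `Q_f^π(s, a)` of a one-step signal `f`. -/
def Q (f : S → A → S → ℝ) (s : S) (a : A) : ℝ :=
  ∫ x, E.discountedReturn f x ∂(E.trajectory π (s, a))

/-- The value function `V_f^π(s) = E_{a ∼ π(s)} Q_f^π(s, a)`. -/
def V (f : S → A → S → ℝ) (s : S) : ℝ :=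
  ∫ a, E.Q π f s a ∂(π.kernel s)

/-- The law of the state `s_t` when `π` is run from the initial state `s₀`. -/
def stateLaw (s₀ : S) (t : ℕ) : Measure S :=
  (((π.kernel s₀).map (Prod.mk s₀)).bind (E.trajectory π)).map (fun x => (x t).1)

/-- The discounted occupancy measure `∑_t γ^t P(s_t ∈ ·)` of `π` run from `s₀`. -/
def occupancy (s₀ : S) : Measure S :=
  Measure.sum fun t : ℕ => ENNReal.ofReal (E.discount ^ t) • E.stateLaw π s₀ t

end Environment

/-- A constrained Markov decision process in the environment `E`: a bounded reward `r(s, a, s')` and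
a utility `c(s, a, s') ∈ [0, 1]`. -/
structure CMDP (E : Environment S A) where
  reward : S → A → S → ℝ
  utility : S → A → S → ℝ
  measurable_reward : Measurable fun x : S × A × S => reward x.1 x.2.1 x.2.2
  measurable_utility : Measurable fun x : S × A × S => utility x.1 x.2.1 x.2.2
  bounded_reward : ∃ B : ℝ, ∀ s a s', |reward s a s'| ≤ B
  utility_nonneg : ∀ s a s', 0 ≤ utility s a s'
  utility_le_one : ∀ s a s', utility s a s' ≤ 1

namespace CMDP

variable {E : Environment S A} (M : CMDP E)

/-- The task is linear in the features `φ`, with reward weights `wr` and utility weights `wc`. -/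
def IsLinear {d : ℕ} (φ : S → A → S → EuclideanSpace ℝ (Fin d))
    (wr wc : EuclideanSpace ℝ (Fin d)) : Prop :=
  (∀ s a s', M.reward s a s' = inner ℝ (φ s a s') wr) ∧
    ∀ s a s', M.utility s a s' = inner ℝ (φ s a s') wc

/-- The Lagrangian `L(π, lam) = V_r^π(s) + lam (V_c^π(s) - τ)` at the state `s`. -/
def lagrangian (τ : ℝ) (s : S) (π : Policy S A) (lam : ℝ) : ℝ :=
  E.V π M.reward s + lam * (E.V π M.utility s - τ)

/-- The Lagrangian action-value `Q_r^π(s, a) + lam (Q_c^π(s, a) - τ)`. -/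
def lagrangianQ (τ : ℝ) (π : Policy S A) (lam : ℝ) (s : S) (a : A) : ℝ :=
  E.Q π M.reward s a + lam * (E.Q π M.utility s a - τ)

/-- The dual function `d(lam) = sup_π L(π, lam)` at the initial state `s₀`. -/
def dual (τ : ℝ) (s₀ : S) (lam : ℝ) : ℝ :=
  ⨆ π : Policy S A, M.lagrangian τ s₀ π lam

/-- `lam` is an optimal dual variable: it minimizes the dual function over `[0, ∞)`. -/
def IsDualOptimal (τ : ℝ) (s₀ : S) (lam : ℝ) : Prop :=
  0 ≤ lam ∧ ∀ μ : ℝ, 0 ≤ μ → M.dual τ s₀ lam ≤ M.dual τ s₀ μ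

/-- Slater's condition in the weak form: some policy meets the constraint at `s₀`. -/
def Slater (τ : ℝ) (s₀ : S) : Prop :=
  ∃ π : Policy S A, τ ≤ E.V π M.utility s₀

/-- `π` is an optimal policy of the CMDP: it is feasible from `s₀`, and it maximizes the value of
the reward at `s₀` among all feasible policies. -/
def IsOptimal (τ : ℝ) (s₀ : S) (π : Policy S A) : Prop :=
  τ ≤ E.V π M.utility s₀ ∧
    ∀ π' : Policy S A, τ ≤ E.V π' M.utility s₀ → E.V π' M.reward s₀ ≤ E.V π M.reward s₀

/-- Convention for the states that `π` does not visit from `s₀`, where the constrained problem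
leaves `π` undetermined: there `π` maximizes the Lagrangian value with multiplier `lam`.  Namely,
this is so at almost every next state with respect to the part of `p(· | s, a)` that is singular to
the occupancy measure of `π`.  If the state space is countable and `γ > 0`, then these are the next
states of `(s, a)` which `π` reaches from `s₀` with probability zero. -/
def IsOptimalOffPath (τ : ℝ) (s₀ : S) (lam : ℝ) (π : Policy S A) : Prop :=
  ∀ s a, ∀ᵐ s' ∂((E.transition (s, a)).singularPart (E.occupancy π s₀)),
    ∀ π' : Policy S A, M.lagrangian τ s' π' lam ≤ M.lagrangian τ s' π lam

end CMDP

/-- In every state `s`, the policy `π` only uses actions that maximize `F s`.  A deterministic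
policy is greedy iff `π(s) ∈ argmax_a F(s, a)` for every `s`. -/
def Policy.IsGreedy (π : Policy S A) (F : S → A → ℝ) : Prop :=
  ∀ s, ∀ᵐ a ∂(π.kernel s), ∀ b, F s b ≤ F s a

end Definitions

end

/-!
# Generalized policy improvement for constrained Markov decision processes

For a multiplier `lam`, the Lagrangian of a task is, up to the constant `lam τ`, the value function
of the single signal `r + lam c`.  All value functions are handled through the Bellman operator
`backup`: the value of a policy is the unique bounded measurable solution of its Bellman equation
(`V_eq_of_bellman`), and every estimate is an instance of one contraction principle
(`le_div_of_contraction`).  Since `A` is finite, value iteration converges to a measurable optimal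
value and a maximizing action can be selected measurably, so no topology on `S` is needed.

*Existence.*  Let `lam` minimize the dual function.  For multipliers approaching `lam` monotonically,
the utilities of maximizing policies are monotone, hence converge in every state; playing in each
state an action that is used infinitely often gives a maximizing policy for `lam` itself with the
limiting utility (`exists_limit_selector`).  Approaching from the right this policy is feasible at
`s₀`, and approaching from the left its utility at `s₀` is at most `τ`.  Mixing the two policies state
by state keeps the Lagrangian maximal, and the utility at `s₀` is continuous in the weight of the
mixture; the intermediate value theorem gives complementary slackness (`IsDualOptimal.exists_saddle`).
The resulting policy is optimal for the constrained problem and maximizes the Lagrangian in *every*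
state, in particular off its path.

*The bound.*  By strong duality any optimal policy maximizes the Lagrangian at `s₀`, hence at almost
every state of its occupancy measure (`IsOptimalValue.ae_occupancy`).  Together with the convention
for the states off its path, the Lebesgue decomposition of `p(· | s, a)` shows that its action values
for the Lagrangian signal are the optimal ones for all `(s, a)` (`IsOptimal.Q_signal_eq`).  The
policy `πj` is then compared with `π` along the chain
`Q_j^{πj} ≈ Q_i^{πj} ≤ Q_i^{πi} ≈ Q_j^{πi} ≲ Q_j^{π}`.  Each of the two changes of signal costs at
most `φ_max · ‖difference of weights‖ / (1 - γ)`, and the last step is a change of multiplier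
followed by generalized policy improvement (`Q_sub_le_of_isGreedy`).
-/

noncomputable section

open Filter Topology

variable {S A : Type*} [MeasurableSpace S] [MeasurableSpace A]

/-! ### Bounded measurable functions -/

/-- Bounded measurable real functions. -/
structure IsBddMeasurable {X : Type*} [MeasurableSpace X] (g : X → ℝ) : Prop where
  measurable : Measurable g
  bounded : ∃ B : ℝ, ∀ x, |g x| ≤ B

namespace IsBddMeasurable

variable {X Y : Type*} [MeasurableSpace X] [MeasurableSpace Y] {g h : X → ℝ}

lemma integrable (hg : IsBddMeasurable g) (μ : Measure X) [IsFiniteMeasure μ] :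
    Integrable g μ := by
  obtain ⟨B, hB⟩ := hg.bounded
  exact Integrable.of_bound hg.measurable.aestronglyMeasurable B (ae_of_all _ hB)

lemma const (c : ℝ) : IsBddMeasurable (fun _ : X => c) := ⟨measurable_const, |c|, fun _ => le_rfl⟩

lemma add (hg : IsBddMeasurable g) (hh : IsBddMeasurable h) :
    IsBddMeasurable (fun x => g x + h x) := by
  obtain ⟨B, hB⟩ := hg.bounded
  obtain ⟨C, hC⟩ := hh.bounded
  exact ⟨hg.measurable.add hh.measurable, B + C,
    fun x => (abs_add_le _ _).trans (add_le_add (hB x) (hC x))⟩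

lemma const_mul (c : ℝ) (hg : IsBddMeasurable g) : IsBddMeasurable (fun x => c * g x) := by
  obtain ⟨B, hB⟩ := hg.bounded
  refine ⟨hg.measurable.const_mul c, |c| * B, fun x => ?_⟩
  rw [abs_mul]
  exact mul_le_mul_of_nonneg_left (hB x) (abs_nonneg c)

lemma sub (hg : IsBddMeasurable g) (hh : IsBddMeasurable h) :
    IsBddMeasurable (fun x => g x - h x) := by
  simpa [sub_eq_add_neg] using hg.add (hh.const_mul (-1))

lemma comp (hg : IsBddMeasurable g) {φ : Y → X} (hφ : Measurable φ) :
    IsBddMeasurable (fun y => g (φ y)) := by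
  obtain ⟨B, hB⟩ := hg.bounded
  exact ⟨hg.measurable.comp hφ, B, fun y => hB _⟩

lemma abs_integral_le {B : ℝ} (hB : ∀ x, |g x| ≤ B) (μ : Measure X) [IsProbabilityMeasure μ] :
    |∫ x, g x ∂μ| ≤ B := by
  simpa using norm_integral_le_of_norm_le_const (μ := μ) (f := g) (ae_of_all _ hB)

lemma integral_kernel {g : X × Y → ℝ} (hg : IsBddMeasurable g) (κ : Kernel X Y)
    [IsMarkovKernel κ] : IsBddMeasurable (fun x => ∫ y, g (x, y) ∂(κ x)) := by
  obtain ⟨B, hB⟩ := hg.bounded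
  exact ⟨(hg.measurable.stronglyMeasurable.integral_kernel_prod_right').measurable, B,
    fun x => abs_integral_le (fun y => hB (x, y)) _⟩

end IsBddMeasurable

/-- A bounded measurable one-step signal `f(s, a, s')`. -/
abbrev IsSignal (f : S → A → S → ℝ) : Prop :=
  IsBddMeasurable fun x : S × A × S => f x.1 x.2.1 x.2.2

lemma IsBddMeasurable.section_right {X Y : Type*} [MeasurableSpace X] [MeasurableSpace Y]
    {g : X → Y → ℝ} (hg : IsBddMeasurable fun z : X × Y => g z.1 z.2) (x : X) :
    IsBddMeasurable (g x) :=
  hg.comp (φ := fun y => (x, y)) (by fun_prop)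

lemma IsSignal.comp_mk {f : S → A → S → ℝ} (hf : IsSignal f) (s : S) (a : A) :
    IsBddMeasurable (f s a) :=
  IsBddMeasurable.comp hf (φ := fun s' => (s, a, s')) (by fun_prop)

lemma IsSignal.add_mul {f g : S → A → S → ℝ} (hf : IsSignal f)
    (hg : IsSignal g) (lam : ℝ) :
    IsSignal fun s a s' => f s a s' + lam * g s a s' :=
  IsBddMeasurable.add hf (IsBddMeasurable.const_mul lam hg)

/-! ### Marginals of the trajectory and the Bellman equation -/

namespace Environment

variable (E : Environment S A) (π : Policy S A)

/-- The law of the state-action pair at time `t`, as a kernel in the initial pair. -/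
def law (t : ℕ) : Kernel (S × A) (S × A) :=
  (E.trajectory π).map fun x => x t

instance law_markov (t : ℕ) : IsMarkovKernel (E.law π t) :=
  Kernel.IsMarkovKernel.map _ (measurable_pi_apply t)

lemma law_zero : E.law π 0 = Kernel.id := by
  ext z : 1
  rw [law, Kernel.map_apply _ (measurable_pi_apply 0), trajectory, Kernel.comap_apply]
  have hf : (fun x : ℕ → S × A => x 0) =
      (fun y : (i : Finset.Iic 0) → S × A => y ⟨0, Finset.mem_Iic.2 le_rfl⟩) ∘
        Preorder.frestrictLe 0 := rfl
  rw [hf, ← Measure.map_map (measurable_pi_apply _) (by fun_prop),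
    Kernel.traj_map_frestrictLe_apply (X := fun _ => S × A), Kernel.partialTraj_self, Kernel.id_apply,
    Measure.map_dirac' (measurable_pi_apply _), Kernel.id_apply]

/-- The Markov property of the trajectory for two consecutive times. -/
lemma trajectory_map_pair (t : ℕ) (z : S × A) :
    (E.trajectory π z).map (fun x => (x t, x (t + 1))) = (E.law π t z) ⊗ₘ (E.step π) := by
  rw [law, Kernel.map_apply _ (measurable_pi_apply t), trajectory, Kernel.comap_apply]
  set x₀ : (i : Finset.Iic 0) → S × A := fun _ => z
  have hp : Measurable fun y : (i : Finset.Iic t) → S × A => y ⟨t, Finset.mem_Iic.2 le_rfl⟩ :=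
    measurable_pi_apply _
  have hf : (fun x : ℕ → S × A => (x t, x (t + 1))) =
      Prod.map (fun y : (i : Finset.Iic t) → S × A => y ⟨t, Finset.mem_Iic.2 le_rfl⟩) id ∘
        (fun x => (Preorder.frestrictLe t x, x (t + 1))) := rfl
  have hg : (fun x : ℕ → S × A => x t) =
      (fun y : (i : Finset.Iic t) → S × A => y ⟨t, Finset.mem_Iic.2 le_rfl⟩) ∘
        Preorder.frestrictLe t := rfl
  rw [hf, hg, ← Measure.map_map (hp.prodMap measurable_id) (by fun_prop),
    ← Kernel.partialTraj_compProd_eq_map_traj (X := fun _ => S × A) (Nat.zero_le t),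
    ← Measure.map_map hp (by fun_prop),
    Kernel.traj_map_frestrictLe_apply (X := fun _ => S × A)]
  set μ := Kernel.partialTraj (X := fun _ => S × A) (E.historyStep π) 0 t x₀
  ext s hs
  rw [Measure.map_apply (hp.prodMap measurable_id) hs, Measure.compProd_apply hs,
    Measure.compProd_apply (hp.prodMap measurable_id hs), lintegral_map _ hp]
  · rfl
  · exact Kernel.measurable_kernel_prodMk_left hs

lemma law_succ (t : ℕ) : E.law π (t + 1) = E.step π ∘ₖ E.law π t := by
  ext z : 1
  rw [Kernel.comp_apply, ← Measure.snd_compProd, ← trajectory_map_pair, Measure.snd,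
    Measure.map_map measurable_snd (by fun_prop), law, Kernel.map_apply _ (measurable_pi_apply _)]
  rfl

lemma law_succ' (t : ℕ) : E.law π (t + 1) = E.law π t ∘ₖ E.step π := by
  induction t with
  | zero => rw [law_succ, law_zero, Kernel.id_comp, Kernel.comp_id]
  | succ t ih => rw [law_succ, ih, ← Kernel.comp_assoc, ← law_succ, ih]

variable {E π}

lemma integral_step {g : S × A → ℝ} (hg : IsBddMeasurable g) (z : S × A) :
    ∫ y, g y ∂(E.step π z) = ∫ s', ∫ a', g (s', a') ∂(π.kernel s') ∂(E.transition z) := by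
  rw [step, ProbabilityTheory.integral_compProd]
  · rfl
  · exact hg.integrable _

variable (E) in
/-- The one-step look-ahead `E[f(s, a, s') + γ v(s')]` for `s' ∼ p(· | s, a)`. -/
def backup (f : S → A → S → ℝ) (v : S → ℝ) (s : S) (a : A) : ℝ :=
  ∫ s', (f s a s' + E.discount * v s') ∂(E.transition (s, a))

variable {f : S → A → S → ℝ} {v : S → ℝ}

lemma isBddMeasurable_backup_integrand (hf : IsSignal f) (hv : IsBddMeasurable v) :
    IsBddMeasurable fun y : (S × A) × S => f y.1.1 y.1.2 y.2 + E.discount * v y.2 :=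
  (IsBddMeasurable.comp hf (φ := fun y : (S × A) × S => (y.1.1, y.1.2, y.2)) (by fun_prop)).add
    ((hv.comp measurable_snd).const_mul _)

lemma isBddMeasurable_backup (hf : IsSignal f) (hv : IsBddMeasurable v) :
    IsBddMeasurable fun z : S × A => E.backup f v z.1 z.2 :=
  (isBddMeasurable_backup_integrand hf hv).integral_kernel E.transition

lemma backup_eq (hf : IsSignal f) (hv : IsBddMeasurable v) (s : S) (a : A) :
    E.backup f v s a = ∫ s', f s a s' ∂(E.transition (s, a)) +
      E.discount * ∫ s', v s' ∂(E.transition (s, a)) := by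
  rw [backup, integral_add ((IsSignal.comp_mk hf s a).integrable _)
    ((hv.const_mul _).integrable _), integral_const_mul]

/-- The expected signal collected at time `t`. -/
lemma integral_signal (hf : IsSignal f) (t : ℕ) (z : S × A) :
    ∫ x, f (x t).1 (x t).2 (x (t + 1)).1 ∂(E.trajectory π z) =
      ∫ y, (∫ s', f y.1 y.2 s' ∂(E.transition y)) ∂(E.law π t z) := by
  have hg : IsBddMeasurable fun y : (S × A) × (S × A) => f y.1.1 y.1.2 y.2.1 :=
    IsBddMeasurable.comp hf (φ := fun y : (S × A) × (S × A) => (y.1.1, y.1.2, y.2.1)) (by fun_prop)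
  have h1 : ∫ x, f (x t).1 (x t).2 (x (t + 1)).1 ∂(E.trajectory π z) =
      ∫ y, f y.1.1 y.1.2 y.2.1 ∂((E.trajectory π z).map (fun x => (x t, x (t + 1)))) :=
    (integral_map (φ := fun x : ℕ → S × A => (x t, x (t + 1))) (by fun_prop)
      hg.measurable.aestronglyMeasurable).symm
  rw [h1, trajectory_map_pair, Measure.integral_compProd (hg.integrable _)]
  congr 1 with y
  rw [integral_step (hg.comp (by fun_prop : Measurable fun w : S × A => (y, w)))]
  simp

lemma discountedReturn_bound {B : ℝ} (hB : ∀ s a s', |f s a s'| ≤ B) (t : ℕ) (x : ℕ → S × A) :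
    ‖E.discount ^ t * f (x t).1 (x t).2 (x (t + 1)).1‖ ≤ E.discount ^ t * B := by
  rw [norm_mul, Real.norm_of_nonneg (pow_nonneg E.discount_nonneg t)]
  exact mul_le_mul_of_nonneg_left (hB _ _ _) (pow_nonneg E.discount_nonneg t)

/-- The action value as a series of expected discounted signals. -/
lemma hasSum_Q (hf : IsSignal f) (s : S) (a : A) :
    HasSum (fun t : ℕ => E.discount ^ t *
      ∫ y, (∫ s', f y.1 y.2 s' ∂(E.transition y)) ∂(E.law π t (s, a))) (E.Q π f s a) := by
  obtain ⟨B, hB⟩ := hf.bounded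
  have hB' : ∀ s a s', |f s a s'| ≤ B := fun s a s' => hB (s, a, s')
  have hm : ∀ t, IsBddMeasurable fun x : ℕ → S × A =>
      E.discount ^ t * f (x t).1 (x t).2 (x (t + 1)).1 := fun t =>
    (IsBddMeasurable.comp hf (φ := fun x : ℕ → S × A => ((x t).1, (x t).2, (x (t + 1)).1))
      (by fun_prop)).const_mul _
  have hsum : Summable fun t : ℕ => ∫ x, ‖E.discount ^ t * f (x t).1 (x t).2 (x (t + 1)).1‖
      ∂(E.trajectory π (s, a)) := by
    refine Summable.of_nonneg_of_le (fun t => integral_nonneg fun x => norm_nonneg _) (fun t => ?_)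
      ((summable_geometric_of_lt_one E.discount_nonneg E.discount_lt_one).mul_right B)
    calc _ ≤ ∫ _, E.discount ^ t * B ∂(E.trajectory π (s, a)) :=
          integral_mono ((hm t).integrable _).norm (integrable_const _)
            (discountedReturn_bound hB' t)
      _ = _ := by simp
  have := hasSum_integral_of_summable_integral_norm (fun t => (hm t).integrable _) hsum
  simp_rw [integral_const_mul, integral_signal hf] at this
  exact this

lemma isBddMeasurable_Q (hf : IsSignal f) :
    IsBddMeasurable fun z : S × A => E.Q π f z.1 z.2 := by
  obtain ⟨B, hB⟩ := hf.bounded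
  have hm : ∀ t, IsBddMeasurable fun x : ℕ → S × A =>
      E.discount ^ t * f (x t).1 (x t).2 (x (t + 1)).1 := fun t =>
    (IsBddMeasurable.comp hf (φ := fun x : ℕ → S × A => ((x t).1, (x t).2, (x (t + 1)).1))
      (by fun_prop)).const_mul _
  have hret : IsBddMeasurable fun x : ℕ → S × A => E.discountedReturn f x := by
    refine ⟨Measurable.tsum (fun t => (hm t).measurable), ∑' t, E.discount ^ t * B, fun x => ?_⟩
    exact tsum_of_norm_bounded
      ((summable_geometric_of_lt_one E.discount_nonneg E.discount_lt_one).mul_right B).hasSum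
      (fun t => discountedReturn_bound (fun s a s' => hB (s, a, s')) t x)
  exact (hret.comp (φ := fun y : (S × A) × (ℕ → S × A) => y.2) measurable_snd).integral_kernel
    (E.trajectory π)

lemma isBddMeasurable_V (hf : IsSignal f) : IsBddMeasurable (E.V π f) :=
  (isBddMeasurable_Q hf).integral_kernel π.kernel

/-- The Bellman equation of a policy. -/
theorem Q_eq_backup (hf : IsSignal f) (s : S) (a : A) :
    E.Q π f s a = E.backup f (E.V π f) s a := by
  have hF : IsBddMeasurable fun y : S × A => ∫ s', f y.1 y.2 s' ∂(E.transition y) :=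
    IsBddMeasurable.integral_kernel (g := fun y : (S × A) × S => f y.1.1 y.1.2 y.2)
      (IsBddMeasurable.comp hf (φ := fun y : (S × A) × S => (y.1.1, y.1.2, y.2)) (by fun_prop))
      E.transition
  set F : S × A → ℝ := fun y => ∫ s', f y.1 y.2 s' ∂(E.transition y) with hFdef
  obtain ⟨B, hB⟩ := hF.bounded
  set u : ℕ → S × A → ℝ := fun t z => E.discount ^ t * ∫ y, F y ∂(E.law π t z) with hu
  have hum : ∀ t, IsBddMeasurable (u t) := fun t =>
    ((hF.comp (φ := fun y : (S × A) × (S × A) => y.2) measurable_snd).integral_kernel _).const_mul _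
  have hub : ∀ t z, ‖u t z‖ ≤ E.discount ^ t * B := fun t z => by
    rw [hu, norm_mul, Real.norm_of_nonneg (pow_nonneg E.discount_nonneg t)]
    exact mul_le_mul_of_nonneg_left (IsBddMeasurable.abs_integral_le hB _)
      (pow_nonneg E.discount_nonneg t)
  have hQ : ∀ z : S × A, HasSum (fun t => u t z) (E.Q π f z.1 z.2) := fun z => hasSum_Q hf z.1 z.2
  have hsucc : ∀ t z, u (t + 1) z = E.discount * ∫ y, u t y ∂(E.step π z) := fun t z => by
    simp only [hu]
    rw [law_succ', Kernel.integral_comp (hF.integrable _), integral_const_mul, pow_succ]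
    ring
  have hsum : Summable fun t : ℕ => ∫ y, ‖u t y‖ ∂(E.step π (s, a)) := by
    refine Summable.of_nonneg_of_le (fun t => integral_nonneg fun x => norm_nonneg _) (fun t => ?_)
      ((summable_geometric_of_lt_one E.discount_nonneg E.discount_lt_one).mul_right B)
    calc _ ≤ ∫ _, E.discount ^ t * B ∂(E.step π (s, a)) :=
          integral_mono ((hum t).integrable _).norm (integrable_const _) (hub t)
      _ = _ := by simp
  have h1 := hasSum_integral_of_summable_integral_norm (fun t => (hum t).integrable _) hsum
  have h2 : (fun z => ∑' t, u t z) = fun z : S × A => E.Q π f z.1 z.2 :=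
    funext fun z => (hQ z).tsum_eq
  rw [h2] at h1
  have h3 := h1.mul_left E.discount
  simp_rw [← hsucc] at h3
  have h4 := (hasSum_nat_add_iff' 1).2 (hQ (s, a))
  have h5 := h4.unique h3
  have h0 : u 0 (s, a) = F (s, a) := by
    simp only [hu, law_zero, pow_zero, one_mul, Kernel.id_apply]
    exact integral_dirac' _ _ hF.measurable.stronglyMeasurable
  rw [backup_eq hf (isBddMeasurable_V hf)]
  rw [integral_step (isBddMeasurable_Q hf)] at h5
  simp only [Finset.sum_range_one, h0] at h5
  simp only [V]
  simp only [hFdef] at h5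
  linarith

end Environment

/-! ### Contraction estimates -/

/-- Sup-norm contraction in one-sided form: every upper bound `C` of `h` improves to `γ C + η`. -/
lemma le_div_of_contraction {X : Type*} {h : X → ℝ} {γ η : ℝ} (hγ : γ < 1)
    (hb : BddAbove (Set.range h)) (H : ∀ C, (∀ x, h x ≤ C) → ∀ x, h x ≤ γ * C + η) (x : X) :
    h x ≤ η / (1 - γ) := by
  have : Nonempty X := ⟨x⟩
  have h1 : (⨆ x, h x) ≤ γ * (⨆ x, h x) + η := ciSup_le (H _ (le_ciSup hb))
  refine (le_ciSup hb x).trans ?_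
  rw [le_div_iff₀ (by linarith)]
  linarith

namespace IsBddMeasurable

variable {X : Type*} [MeasurableSpace X] {g h : X → ℝ}

lemma bddAbove (hg : IsBddMeasurable g) : BddAbove (Set.range g) := by
  obtain ⟨B, hB⟩ := hg.bounded
  exact ⟨B, by rintro _ ⟨x, rfl⟩; exact (le_abs_self _).trans (hB x)⟩

lemma integral_sub_le (hg : IsBddMeasurable g) (hh : IsBddMeasurable h) {C : ℝ}
    (μ : Measure X) [IsProbabilityMeasure μ] (H : ∀ᵐ x ∂μ, g x - h x ≤ C) :
    ∫ x, g x ∂μ - ∫ x, h x ∂μ ≤ C := by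
  rw [← integral_sub (hg.integrable _) (hh.integrable _)]
  calc _ ≤ ∫ _, C ∂μ := integral_mono_ae ((hg.sub hh).integrable _) (integrable_const _) H
    _ = C := by simp

end IsBddMeasurable

namespace Environment

variable {E : Environment S A} {π : Policy S A} {f g : S → A → S → ℝ} {v w : S → ℝ}

lemma one_sub_discount_pos (E : Environment S A) : 0 < 1 - E.discount := by
  linarith [E.discount_lt_one]

lemma backup_sub_le (hf : IsSignal f) (hg : IsSignal g) (hv : IsBddMeasurable v)
    (hw : IsBddMeasurable w) {C δ : ℝ} {s : S} {a : A} (hvw : ∀ s', v s' - w s' ≤ C)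
    (hfg : ∀ s', f s a s' - g s a s' ≤ δ) :
    E.backup f v s a - E.backup g w s a ≤ E.discount * C + δ := by
  refine ((IsSignal.comp_mk hf s a).add (hv.const_mul _)).integral_sub_le
    ((IsSignal.comp_mk hg s a).add (hw.const_mul _)) _ (ae_of_all _ fun s' => ?_)
  have := mul_le_mul_of_nonneg_left (hvw s') E.discount_nonneg
  linarith [hfg s']

/-- The value function of a policy is the only bounded measurable solution of its Bellman
equation. -/
theorem V_eq_of_bellman (hf : IsSignal f) (hv : IsBddMeasurable v)
    (h : ∀ s, v s = ∫ a, E.backup f v s a ∂(π.kernel s)) : E.V π f = v := by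
  have hV := isBddMeasurable_V (E := E) (π := π) hf
  have key : ∀ {u w : S → ℝ}, IsBddMeasurable u → IsBddMeasurable w →
      (∀ s, u s = ∫ a, E.backup f u s a ∂(π.kernel s)) →
      (∀ s, w s = ∫ a, E.backup f w s a ∂(π.kernel s)) → ∀ s, u s - w s ≤ 0 := by
    intro u w hu hw hu' hw' s
    have := le_div_of_contraction (η := 0) E.discount_lt_one (hu.sub hw).bddAbove
      (fun C hC s => by
        rw [hu', hw']
        exact (isBddMeasurable_backup hf hu).section_right s |>.integral_sub_le
          ((isBddMeasurable_backup hf hw).section_right s) _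
          (ae_of_all _ fun a => backup_sub_le hf hf hu hw hC fun _ => by simp)) s
    simpa using this
  have hV' : ∀ s, E.V π f s = ∫ a, E.backup f (E.V π f) s a ∂(π.kernel s) := fun s => by
    simp_rw [← Q_eq_backup hf]; rfl
  funext s
  linarith [key hV hv hV' h s, key hv hV h hV' s]

lemma V_sub_le (hf : IsSignal f) (hg : IsSignal g) {δ : ℝ} (h : ∀ s a s', f s a s' - g s a s' ≤ δ)
    (s : S) : E.V π f s - E.V π g s ≤ δ / (1 - E.discount) := by
  refine le_div_of_contraction E.discount_lt_one
    ((isBddMeasurable_V hf).sub (isBddMeasurable_V hg)).bddAbove (fun C hC s => ?_) s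
  refine ((isBddMeasurable_Q hf).section_right s).integral_sub_le
    ((isBddMeasurable_Q hg).section_right s) _ (ae_of_all _ fun a => ?_)
  rw [Q_eq_backup hf, Q_eq_backup hg]
  exact backup_sub_le hf hg (isBddMeasurable_V hf) (isBddMeasurable_V hg) hC (h s a)

lemma Q_sub_le (hf : IsSignal f) (hg : IsSignal g) {δ : ℝ} (h : ∀ s a s', f s a s' - g s a s' ≤ δ)
    (s : S) (a : A) : E.Q π f s a - E.Q π g s a ≤ δ / (1 - E.discount) := by
  rw [Q_eq_backup hf, Q_eq_backup hg]
  refine (backup_sub_le hf hg (isBddMeasurable_V hf) (isBddMeasurable_V hg) (V_sub_le hf hg h)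
    (h s a)).trans_eq ?_
  field_simp [E.one_sub_discount_pos.ne']
  ring

lemma backup_add_mul (hf : IsSignal f) (hg : IsSignal g) (hv : IsBddMeasurable v)
    (hw : IsBddMeasurable w) (lam : ℝ) (s : S) (a : A) :
    E.backup (fun s a s' => f s a s' + lam * g s a s') (fun s => v s + lam * w s) s a =
      E.backup f v s a + lam * E.backup g w s a := by
  have h1 := ((IsSignal.comp_mk hf s a).add (hv.const_mul E.discount)).integrable
    (E.transition (s, a))
  have h2 := ((IsSignal.comp_mk hg s a).add (hw.const_mul E.discount)).integrable
    (E.transition (s, a))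
  rw [backup, backup, backup, ← integral_const_mul, ← integral_add h1 (h2.const_mul lam)]
  congr 1 with s'
  ring

lemma V_add_mul (hf : IsSignal f) (hg : IsSignal g) (lam : ℝ) (s : S) :
    E.V π (fun s a s' => f s a s' + lam * g s a s') s = E.V π f s + lam * E.V π g s := by
  refine congrFun (V_eq_of_bellman (v := fun s => E.V π f s + lam * E.V π g s)
    (IsSignal.add_mul hf hg lam)
    ((isBddMeasurable_V hf).add ((isBddMeasurable_V hg).const_mul lam)) fun s => ?_) s
  have h1 := ((isBddMeasurable_Q (E := E) (π := π) hf).section_right s).integrable (π.kernel s)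
  have h2 := ((isBddMeasurable_Q (E := E) (π := π) hg).section_right s).integrable (π.kernel s)
  have hb : ∀ a, E.backup (fun s a s' => f s a s' + lam * g s a s')
      (fun s => E.V π f s + lam * E.V π g s) s a = E.Q π f s a + lam * E.Q π g s a := fun a => by
    rw [backup_add_mul hf hg (isBddMeasurable_V hf) (isBddMeasurable_V hg), ← Q_eq_backup hf,
      ← Q_eq_backup hg]
  rw [integral_congr_ae (ae_of_all _ hb), integral_add h1 (h2.const_mul lam), integral_const_mul]
  rfl

lemma Q_add_mul (hf : IsSignal f) (hg : IsSignal g) (lam : ℝ) (s : S) (a : A) :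
    E.Q π (fun s a s' => f s a s' + lam * g s a s') s a = E.Q π f s a + lam * E.Q π g s a := by
  rw [Q_eq_backup (IsSignal.add_mul hf hg lam), Q_eq_backup hf, Q_eq_backup hg,
    ← backup_add_mul hf hg (isBddMeasurable_V hf) (isBddMeasurable_V hg)]
  congr 1
  funext s
  exact V_add_mul hf hg lam s

lemma abs_Q_le (hf : IsSignal f) {B : ℝ} (hB : ∀ s a s', |f s a s'| ≤ B) (s : S) (a : A) :
    |E.Q π f s a| ≤ B / (1 - E.discount) := by
  have h0 : IsSignal fun (_ : S) (_ : A) (_ : S) => (0 : ℝ) := IsBddMeasurable.const 0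
  have hQ0 : E.Q π (fun _ _ _ => 0) s a = 0 := by simp [Q, discountedReturn]
  have h1 := Q_sub_le (E := E) (π := π) hf h0 (δ := B)
    (fun s a s' => by linarith [le_abs_self (f s a s'), hB s a s']) s a
  have h2 := Q_sub_le (E := E) (π := π) h0 hf (δ := B)
    (fun s a s' => by linarith [neg_abs_le (f s a s'), hB s a s']) s a
  rw [abs_le]
  constructor <;> linarith

lemma abs_V_le (hf : IsSignal f) {B : ℝ} (hB : ∀ s a s', |f s a s'| ≤ B) (s : S) :
    |E.V π f s| ≤ B / (1 - E.discount) :=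
  IsBddMeasurable.abs_integral_le (abs_Q_le hf hB s) _

/-- Dominated convergence for the one-step look-ahead. -/
lemma tendsto_backup {F : ℕ → S → A → S → ℝ} {u : ℕ → S → ℝ} (hF : ∀ n, IsSignal (F n))
    (hu : ∀ n, IsBddMeasurable (u n)) {B C : ℝ} (hB : ∀ n s a s', |F n s a s'| ≤ B)
    (hC : ∀ n s, |u n s| ≤ C) (hFf : ∀ s a s', Tendsto (fun n => F n s a s') atTop (𝓝 (f s a s')))
    (huv : ∀ s, Tendsto (fun n => u n s) atTop (𝓝 (v s))) (s : S) (a : A) :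
    Tendsto (fun n => E.backup (F n) (u n) s a) atTop (𝓝 (E.backup f v s a)) := by
  refine tendsto_integral_of_dominated_convergence (fun _ => B + E.discount * C)
    (fun n => ((IsSignal.comp_mk (hF n) s a).add
      ((hu n).const_mul _)).measurable.aestronglyMeasurable) (integrable_const _)
    (fun n => ae_of_all _ fun s' => ?_)
    (ae_of_all _ fun s' => (hFf s a s').add ((huv s').const_mul _))
  refine (norm_add_le _ _).trans (add_le_add (hB n s a s') ?_)
  rw [norm_mul, Real.norm_of_nonneg E.discount_nonneg]
  exact mul_le_mul_of_nonneg_left (hC n s') E.discount_nonneg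

end Environment

/-! ### Finite action sets: measurable selection and deterministic policies -/

lemma exists_frequently_of_finite {ι : Type*} [Finite ι] {P : ℕ → ι → Prop}
    (h : ∀ n, ∃ a, P n a) :
    ∃ a, ∃ᶠ n in atTop, P n a := by
  by_contra! H
  obtain ⟨n, hn⟩ := (eventually_all.2 H).exists
  obtain ⟨a, ha⟩ := h n
  exact hn a ha

lemma exists_measurable_selector [Finite A] [Nonempty A] {P : S → A → Prop}
    (hP : ∀ a, MeasurableSet {s | P s a}) (h : ∀ s, ∃ a, P s a) :
    ∃ σ : S → A, Measurable σ ∧ ∀ s, P s (σ s) := by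
  classical
  obtain ⟨e, he⟩ := exists_surjective_nat A
  have h' : ∀ s, ∃ n, P s (e n) := fun s => by
    obtain ⟨a, ha⟩ := h s
    obtain ⟨n, rfl⟩ := he a
    exact ⟨n, ha⟩
  exact ⟨fun s => e (Nat.find (h' s)),
    measurable_from_top.comp (measurable_find h' fun n => hP (e n)), fun s => Nat.find_spec (h' s)⟩

/-- The deterministic policy that plays `σ s` in the state `s`. -/
def Policy.deterministic (σ : S → A) (hσ : Measurable σ) : Policy S A :=
  ⟨Kernel.deterministic σ hσ, inferInstance⟩

lemma Policy.ext_kernel {π ρ : Policy S A} (h : ∀ s, π.kernel s = ρ.kernel s) : π = ρ := by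
  have := Kernel.ext h
  cases π
  cases ρ
  simp_all

/-- The policy that plays `σ₁ s` with probability `θ` and `σ₂ s` with probability `1 - θ`. -/
def Policy.mix (σ₁ σ₂ : S → A) (h₁ : Measurable σ₁) (h₂ : Measurable σ₂) (θ : unitInterval) :
    Policy S A where
  kernel :=
    { toFun := fun s => ENNReal.ofReal θ • Measure.dirac (σ₁ s) +
        ENNReal.ofReal (1 - θ) • Measure.dirac (σ₂ s)
      measurable' := by
        refine Measure.measurable_of_measurable_coe _ fun t ht => ?_
        simp only [Measure.coe_add, Measure.coe_smul, Pi.add_apply, Pi.smul_apply, smul_eq_mul]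
        exact (((Measure.measurable_coe ht).comp
          (Measure.measurable_dirac.comp h₁)).const_mul _).add
          (((Measure.measurable_coe ht).comp (Measure.measurable_dirac.comp h₂)).const_mul _) }
  markov := ⟨fun s => ⟨by
    have : ENNReal.ofReal (θ : ℝ) + ENNReal.ofReal (1 - θ) = 1 := by
      rw [← ENNReal.ofReal_add θ.2.1 (by linarith [θ.2.2])]
      simp
    simpa using this⟩⟩

section Mix

variable [MeasurableSingletonClass A] {σ₁ σ₂ : S → A} {h₁ : Measurable σ₁} {h₂ : Measurable σ₂}

lemma Policy.integral_deterministic (g : A → ℝ) (s : S) :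
    ∫ a, g a ∂((Policy.deterministic σ₁ h₁).kernel s) = g (σ₁ s) := by
  simp [Policy.deterministic, Kernel.deterministic_apply]

lemma Policy.ae_deterministic {P : A → Prop} {s : S} (h : P (σ₁ s)) :
    ∀ᵐ a ∂((Policy.deterministic σ₁ h₁).kernel s), P a := by
  simpa [Policy.deterministic, Kernel.deterministic_apply, ae_dirac_eq] using h

lemma Policy.integral_mix (θ : unitInterval) {g : A → ℝ} (hg : IsBddMeasurable g) (s : S) :
    ∫ a, g a ∂((Policy.mix σ₁ σ₂ h₁ h₂ θ).kernel s) = θ * g (σ₁ s) + (1 - θ) * g (σ₂ s) := by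
  change ∫ a, g a ∂(ENNReal.ofReal θ • Measure.dirac (σ₁ s) +
        ENNReal.ofReal (1 - θ) • Measure.dirac (σ₂ s)) = _
  rw [integral_add_measure ((hg.integrable _).smul_measure ENNReal.ofReal_ne_top)
    ((hg.integrable _).smul_measure ENNReal.ofReal_ne_top), integral_smul_measure,
    integral_smul_measure, integral_dirac, integral_dirac, ENNReal.toReal_ofReal θ.2.1,
    ENNReal.toReal_ofReal (by linarith [θ.2.2])]
  simp

lemma Policy.ae_mix {θ : unitInterval} {P : A → Prop} {s : S} (hp₁ : P (σ₁ s)) (hp₂ : P (σ₂ s)) :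
    ∀ᵐ a ∂((Policy.mix σ₁ σ₂ h₁ h₂ θ).kernel s), P a := by
  change ∀ᵐ a ∂(ENNReal.ofReal θ • Measure.dirac (σ₁ s) +
        ENNReal.ofReal (1 - θ) • Measure.dirac (σ₂ s)), P a
  rw [ae_add_measure_iff]
  exact ⟨Measure.ae_smul_measure (by simpa [ae_dirac_eq] using hp₁) _,
    Measure.ae_smul_measure (by simpa [ae_dirac_eq] using hp₂) _⟩

end Mix

/-! ### The Bellman optimality equation -/

namespace Environment

variable {E : Environment S A} {π : Policy S A} {f g : S → A → S → ℝ} {v w : S → ℝ}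

/-- `v` is a bounded measurable solution of the Bellman optimality equation
`v(s) = max_a E[f(s, a, s') + γ v(s')]`. -/
structure IsOptimalValue (E : Environment S A) (f : S → A → S → ℝ) (v : S → ℝ) : Prop where
  isBddMeasurable : IsBddMeasurable v
  backup_le : ∀ s a, E.backup f v s a ≤ v s
  exists_eq : ∀ s, ∃ a, E.backup f v s a = v s

lemma IsOptimalValue.V_le (h : E.IsOptimalValue f v) (hf : IsSignal f) (π : Policy S A) (s : S) :
    E.V π f s ≤ v s := by
  have hV := isBddMeasurable_V (E := E) (π := π) hf
  have := le_div_of_contraction (η := 0) E.discount_lt_one (hV.sub h.isBddMeasurable).bddAbove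
    (fun C hC s => by
      have h1 := ((isBddMeasurable_Q (E := E) (π := π) hf).section_right s).integral_sub_le
        (IsBddMeasurable.const (v s)) (π.kernel s) (C := E.discount * C + 0)
        (ae_of_all _ fun a => by
          rw [Q_eq_backup hf]
          have := backup_sub_le (E := E) hf hf hV h.isBddMeasurable (a := a) (s := s) hC
            (δ := 0) (fun _ => by simp)
          linarith [h.backup_le s a])
      simpa [V] using h1) s
  simpa using this

lemma IsOptimalValue.Q_le (h : E.IsOptimalValue f v) (hf : IsSignal f) (π : Policy S A) (s : S)
    (a : A) : E.Q π f s a ≤ E.backup f v s a := by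
  rw [Q_eq_backup hf]
  have := backup_sub_le (E := E) hf hf (isBddMeasurable_V hf) h.isBddMeasurable (a := a) (s := s)
    (C := 0) (δ := 0) (fun s => by linarith [h.V_le hf π s]) (fun _ => by simp)
  linarith

/-- A policy that only uses maximizing actions attains the optimal value in every state. -/
lemma IsOptimalValue.V_eq (h : E.IsOptimalValue f v) (hf : IsSignal f)
    (hπ : ∀ s, ∀ᵐ a ∂(π.kernel s), E.backup f v s a = v s) : E.V π f = v := by
  refine V_eq_of_bellman hf h.isBddMeasurable fun s => ?_
  rw [integral_congr_ae (hπ s)]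
  simp

lemma measurableSet_backup_eq (hf : IsSignal f) (hv : IsBddMeasurable v) (a : A) :
    MeasurableSet {s | E.backup f v s a = v s} :=
  measurableSet_eq_fun ((isBddMeasurable_backup hf hv).measurable.comp
    (f := fun s => (s, a)) (by fun_prop)) hv.measurable

variable [Finite A] [Nonempty A]

lemma IsOptimalValue.exists_selector (h : E.IsOptimalValue f v) (hf : IsSignal f) :
    ∃ σ : S → A, Measurable σ ∧ ∀ s, E.backup f v s (σ s) = v s :=
  exists_measurable_selector (measurableSet_backup_eq hf h.isBddMeasurable) h.exists_eq

/-- Value iteration from below converges to a solution of the Bellman optimality equation. -/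
theorem exists_isOptimalValue (E : Environment S A) (hf : IsSignal f) :
    ∃ v, E.IsOptimalValue f v := by
  obtain ⟨B, hB'⟩ := hf.bounded
  have hB : ∀ s a s', |f s a s'| ≤ B := fun s a s' => hB' (s, a, s')
  have hγ := E.one_sub_discount_pos
  set C := B / (1 - E.discount) with hC
  have hCB : E.discount * C + B = C := by
    rw [hC]; field_simp [hγ.ne']; ring
  set T : (S → ℝ) → S → ℝ := fun v s => ⨆ a, E.backup f v s a with hT
  -- `-C` is a lower bound of all values, so that the iteration increases
  set u : ℕ → S → ℝ := fun n => T^[n] (fun _ => -C) with hu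
  have hu1 : ∀ n, u (n + 1) = T (u n) := fun n => Function.iterate_succ_apply' T n _
  have hfin : ∀ (v : S → ℝ) (s : S), BddAbove (Set.range fun a => E.backup f v s a) :=
    fun v s => (Set.finite_range _).bddAbove
  have habs : ∀ {v : S → ℝ}, IsBddMeasurable v → (∀ s, |v s| ≤ C) → ∀ s a,
      |E.backup f v s a| ≤ C := fun {v} hv h s a => by
    refine IsBddMeasurable.abs_integral_le (fun s' => (abs_add_le _ _).trans ?_) _
    rw [abs_mul, abs_of_nonneg E.discount_nonneg]
    linarith [hB s a s', mul_le_mul_of_nonneg_left (h s') E.discount_nonneg]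
  have hsup : ∀ (v : S → ℝ) (s : S), ∃ a, E.backup f v s a = T v s := fun v s =>
    exists_eq_ciSup_of_finite
  have hind : ∀ n, IsBddMeasurable (u n) ∧ ∀ s, |u n s| ≤ C := by
    intro n
    induction n with
    | zero =>
      refine ⟨IsBddMeasurable.const _, fun s => ?_⟩
      change |-C| ≤ C
      have hB0 : 0 ≤ B := by
        obtain ⟨a⟩ := ‹Nonempty A›
        exact (abs_nonneg _).trans (hB s a s)
      rw [abs_neg, abs_of_nonneg (by positivity)]
    | succ n ih =>
      have hb : ∀ s, |u (n + 1) s| ≤ C := fun s => by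
        rw [hu1]
        obtain ⟨a, ha⟩ := hsup (u n) s
        rw [← ha]
        exact habs ih.1 ih.2 s a
      refine ⟨⟨?_, C, hb⟩, hb⟩
      rw [hu1]
      exact Measurable.iSup fun a => (isBddMeasurable_backup hf ih.1).measurable.comp
        (f := fun s => (s, a)) (by fun_prop)
  have hmono : ∀ n s, u n s ≤ u (n + 1) s := by
    intro n
    induction n with
    | zero =>
      intro s
      exact (abs_le.1 ((hind 1).2 s)).1
    | succ n ih =>
      intro s
      rw [hu1 n, hu1 (n + 1)]
      refine ciSup_mono (hfin _ s) fun a => ?_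
      have := backup_sub_le (E := E) hf hf (hind n).1 (hind (n + 1)).1 (C := 0) (δ := 0) (s := s)
        (a := a) (fun s' => by linarith [ih s']) (fun _ => by simp)
      linarith
  set v : S → ℝ := fun s => ⨆ n, u n s with hv
  have hlim : ∀ s, Tendsto (fun n => u n s) atTop (𝓝 (v s)) := fun s =>
    tendsto_atTop_ciSup (monotone_nat_of_le_succ fun n => hmono n s)
      ⟨C, by rintro _ ⟨n, rfl⟩; exact (le_abs_self _).trans ((hind n).2 s)⟩
  have hlim' : ∀ s, Tendsto (fun n => u (n + 1) s) atTop (𝓝 (v s)) := fun s =>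
    (hlim s).comp (tendsto_add_atTop_nat 1)
  have hvm : IsBddMeasurable v :=
    ⟨measurable_of_tendsto_metrizable (fun n => (hind n).1.measurable) (tendsto_pi_nhds.2 hlim), C,
      fun s => le_of_tendsto (hlim s).abs (Eventually.of_forall fun n => (hind n).2 s)⟩
  have hback := fun s a => tendsto_backup (E := E) (F := fun _ => f) (u := u) (fun _ => hf)
    (fun n => (hind n).1) (fun _ => hB) (fun n => (hind n).2) (fun _ _ _ => tendsto_const_nhds)
    hlim s a
  refine ⟨v, hvm, fun s a => ?_, fun s => ?_⟩
  · refine le_of_tendsto_of_tendsto' (hback s a) (hlim' s) fun n => ?_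
    rw [hu1]
    exact le_ciSup (hfin (u n) s) a
  · obtain ⟨a, ha⟩ := exists_frequently_of_finite fun n => hsup (u n) s
    refine ⟨a, tendsto_nhds_unique_of_frequently_eq (hback s a) (hlim' s) (ha.mono fun n hn => ?_)⟩
    rw [hn, hu1]

end Environment

/-! ### Continuity of mixtures -/

namespace Environment

variable {E : Environment S A} {f g : S → A → S → ℝ} {v w : S → ℝ}

/-- The value of a mixture of two deterministic policies depends continuously on the weight. -/
lemma continuous_V_mix [MeasurableSingletonClass A] (hf : IsSignal f) {σ₁ σ₂ : S → A}
    (h₁ : Measurable σ₁) (h₂ : Measurable σ₂) (s : S) :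
    Continuous fun θ : unitInterval => E.V (Policy.mix σ₁ σ₂ h₁ h₂ θ) f s := by
  obtain ⟨B, hB'⟩ := hf.bounded
  have hB : ∀ s a s', |f s a s'| ≤ B := fun s a s' => hB' (s, a, s')
  have hγ := E.one_sub_discount_pos
  have hB0 : 0 ≤ B := (abs_nonneg _).trans (hB s (σ₁ s) s)
  set K : ℝ := 2 * (B / (1 - E.discount)) with hK
  have hK0 : 0 ≤ K := by positivity
  have hKK : 0 ≤ K / (1 - E.discount) := by positivity
  refine LipschitzWith.continuous (K := ⟨K / (1 - E.discount), hKK⟩)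
    (LipschitzWith.of_le_add_mul _ fun θ θ' => ?_)
  have hV : ∀ (η : unitInterval) s, E.V (Policy.mix σ₁ σ₂ h₁ h₂ η) f s =
      η * E.Q (Policy.mix σ₁ σ₂ h₁ h₂ η) f s (σ₁ s) +
        (1 - η) * E.Q (Policy.mix σ₁ σ₂ h₁ h₂ η) f s (σ₂ s) := fun η s =>
    Policy.integral_mix η ((isBddMeasurable_Q hf).section_right s) s
  have hd : dist θ θ' = |(θ : ℝ) - θ'| := rfl
  have := le_div_of_contraction (η := K * |(θ : ℝ) - θ'|) E.discount_lt_one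
    ((isBddMeasurable_V (E := E) (π := Policy.mix σ₁ σ₂ h₁ h₂ θ) hf).sub
      (isBddMeasurable_V (E := E) (π := Policy.mix σ₁ σ₂ h₁ h₂ θ') hf)).bddAbove
    (fun C hC s => by
      have hQ : ∀ a, E.Q (Policy.mix σ₁ σ₂ h₁ h₂ θ) f s a -
          E.Q (Policy.mix σ₁ σ₂ h₁ h₂ θ') f s a ≤ E.discount * C := fun a => by
        rw [Q_eq_backup hf, Q_eq_backup hf]
        have := backup_sub_le (E := E) hf hf
          (isBddMeasurable_V (E := E) (π := Policy.mix σ₁ σ₂ h₁ h₂ θ) hf)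
          (isBddMeasurable_V (E := E) (π := Policy.mix σ₁ σ₂ h₁ h₂ θ') hf) (s := s) (a := a)
          (δ := 0) hC (fun _ => by simp)
        linarith
      have hdiff : ((θ : ℝ) - θ') * (E.Q (Policy.mix σ₁ σ₂ h₁ h₂ θ') f s (σ₁ s) -
          E.Q (Policy.mix σ₁ σ₂ h₁ h₂ θ') f s (σ₂ s)) ≤ K * |(θ : ℝ) - θ'| := by
        refine (le_abs_self _).trans ?_
        rw [abs_mul, mul_comm]
        refine mul_le_mul_of_nonneg_right ?_ (abs_nonneg _)
        have h1 := abs_Q_le (E := E) (π := Policy.mix σ₁ σ₂ h₁ h₂ θ') hf hB s (σ₁ s)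
        have h2 := abs_Q_le (E := E) (π := Policy.mix σ₁ σ₂ h₁ h₂ θ') hf hB s (σ₂ s)
        refine (abs_sub _ _).trans ?_
        linarith
      rw [hV θ, hV θ']
      have e1 := mul_le_mul_of_nonneg_left (hQ (σ₁ s)) θ.2.1
      have e2 := mul_le_mul_of_nonneg_left (hQ (σ₂ s)) (sub_nonneg.2 θ.2.2)
      linarith) s
  rw [hd]
  change _ ≤ _ + K / (1 - E.discount) * |(θ : ℝ) - θ'|
  rw [div_mul_eq_mul_div]
  linarith

variable [MeasurableSingletonClass A]

lemma IsOptimalValue.V_deterministic (h : E.IsOptimalValue f v) (hf : IsSignal f) {σ : S → A}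
    (hσ : Measurable σ) (hmax : ∀ s, E.backup f v s (σ s) = v s) :
    E.V (Policy.deterministic σ hσ) f = v :=
  h.V_eq hf fun s => Policy.ae_deterministic (hmax s)

variable [Finite A] [Nonempty A]

lemma IsOptimalValue.sub_le (hv : E.IsOptimalValue f v) (hw : E.IsOptimalValue g w)
    (hf : IsSignal f) (hg : IsSignal g) {δ : ℝ} (h : ∀ s a s', f s a s' - g s a s' ≤ δ) (s : S) :
    v s - w s ≤ δ / (1 - E.discount) := by
  obtain ⟨σ, hσ, hmax⟩ := hv.exists_selector hf
  have h1 := V_sub_le (E := E) (π := Policy.deterministic σ hσ) hf hg h s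
  rw [hv.V_deterministic hf hσ hmax] at h1
  linarith [hw.V_le hg (Policy.deterministic σ hσ) s]

end Environment

/-! ### Strong duality -/

namespace CMDP

open Environment

variable {E : Environment S A} (M : CMDP E) {v : S → ℝ} {lam τ : ℝ} {s₀ : S}

/-- The signal `r + lam c`, whose value function is the Lagrangian up to the constant `lam τ`. -/
def signal (lam : ℝ) : S → A → S → ℝ := fun s a s' => M.reward s a s' + lam * M.utility s a s'

lemma isSignal_reward : IsSignal M.reward := by
  obtain ⟨B, hB⟩ := M.bounded_reward
  exact ⟨M.measurable_reward, B, fun _ => hB _ _ _⟩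

lemma abs_utility_le (s : S) (a : A) (s' : S) : |M.utility s a s'| ≤ 1 := by
  rw [abs_of_nonneg (M.utility_nonneg s a s')]
  exact M.utility_le_one s a s'

lemma isSignal_utility : IsSignal M.utility :=
  ⟨M.measurable_utility, 1, fun _ => M.abs_utility_le _ _ _⟩

lemma isSignal_signal (lam : ℝ) : IsSignal (M.signal lam) :=
  IsSignal.add_mul M.isSignal_reward M.isSignal_utility lam

lemma V_signal (π : Policy S A) (lam : ℝ) (s : S) :
    E.V π (M.signal lam) s = E.V π M.reward s + lam * E.V π M.utility s :=
  V_add_mul M.isSignal_reward M.isSignal_utility lam s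

lemma lagrangian_eq (τ : ℝ) (s : S) (π : Policy S A) (lam : ℝ) :
    M.lagrangian τ s π lam = E.V π (M.signal lam) s - lam * τ := by
  rw [V_signal, lagrangian]; ring

lemma lagrangianQ_eq (τ : ℝ) (π : Policy S A) (lam : ℝ) (s : S) (a : A) :
    M.lagrangianQ τ π lam s a = E.Q π (M.signal lam) s a - lam * τ := by
  have h : E.Q π (M.signal lam) s a = E.Q π M.reward s a + lam * E.Q π M.utility s a :=
    Q_add_mul M.isSignal_reward M.isSignal_utility lam s a
  rw [h, lagrangianQ]
  ring

lemma abs_signal_sub_le (lam μ : ℝ) (s : S) (a : A) (s' : S) :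
    |M.signal lam s a s' - M.signal μ s a s'| ≤ |lam - μ| := by
  have : M.signal lam s a s' - M.signal μ s a s' = (lam - μ) * M.utility s a s' := by
    simp only [signal]; ring
  rw [this, abs_mul]
  exact mul_le_of_le_one_right (abs_nonneg _) (M.abs_utility_le s a s')

/-- Utilities of optimal policies are monotone in the multiplier. -/
lemma mul_V_utility_sub_nonneg {μ : ℝ} {w : S → ℝ} {π ρ : Policy S A}
    (hv : E.IsOptimalValue (M.signal lam) v) (hw : E.IsOptimalValue (M.signal μ) w)
    (hπ : E.V π (M.signal lam) = v) (hρ : E.V ρ (M.signal μ) = w) (s : S) :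
    0 ≤ (μ - lam) * (E.V ρ M.utility s - E.V π M.utility s) := by
  have h1 := hv.V_le (M.isSignal_signal lam) ρ s
  have h2 := hw.V_le (M.isSignal_signal μ) π s
  rw [← hπ, V_signal, V_signal] at h1
  rw [← hρ, V_signal, V_signal] at h2
  linarith

variable [MeasurableSingletonClass A] [Finite A] [Nonempty A]

lemma dual_eq (hv : E.IsOptimalValue (M.signal lam) v) : M.dual τ s₀ lam = v s₀ - lam * τ := by
  obtain ⟨σ, hσ, hmax⟩ := hv.exists_selector (M.isSignal_signal lam)
  have : Nonempty (Policy S A) := ⟨Policy.deterministic σ hσ⟩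
  simp only [dual, lagrangian_eq]
  refine le_antisymm (ciSup_le fun π => ?_) ?_
  · linarith [hv.V_le (M.isSignal_signal lam) π s₀]
  · rw [← hv.V_deterministic (M.isSignal_signal lam) hσ hmax]
    refine le_ciSup (f := fun π => E.V π (M.signal lam) s₀ - lam * τ) ⟨v s₀ - lam * τ, ?_⟩
      (Policy.deterministic σ hσ)
    rintro _ ⟨π, rfl⟩
    exact sub_le_sub_right (hv.V_le (M.isSignal_signal lam) π s₀) _

/-- A minimizer of the dual function separates the multipliers at which the optimal policies
satisfy the constraint from those at which they violate it. -/
lemma IsDualOptimal.mul_sub_nonneg {M : CMDP E} {μ : ℝ} {w : S → ℝ} {ρ : Policy S A}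
    (h : M.IsDualOptimal τ s₀ lam) (hμ : 0 ≤ μ) (hw : E.IsOptimalValue (M.signal μ) w)
    (hρ : E.V ρ (M.signal μ) = w) : 0 ≤ (μ - lam) * (E.V ρ M.utility s₀ - τ) := by
  obtain ⟨v, hv⟩ := exists_isOptimalValue E (M.isSignal_signal lam)
  have h1 := h.2 μ hμ
  rw [M.dual_eq hv, M.dual_eq hw, ← hρ, V_signal] at h1
  have h2 := hv.V_le (M.isSignal_signal lam) ρ s₀
  rw [V_signal] at h2
  linarith

/-- If the multipliers `l n` tend to `lam` and the utilities of maximizing policies `σ n` for `l n`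
converge, then the limit is the utility of a maximizing policy for `lam`: in every state play an
action that the policies `σ n` use infinitely often. -/
lemma exists_limit_selector {l : ℕ → ℝ} (hl : Tendsto l atTop (𝓝 lam))
    (hv : E.IsOptimalValue (M.signal lam) v) {w : ℕ → S → ℝ}
    (hw : ∀ n, E.IsOptimalValue (M.signal (l n)) (w n)) {σ : ℕ → S → A}
    (hσ : ∀ n, Measurable (σ n)) (hmax : ∀ n s, E.backup (M.signal (l n)) (w n) s (σ n s) = w n s)
    (hlim : ∀ s, ∃ D, Tendsto (fun n => E.V (Policy.deterministic (σ n) (hσ n)) M.utility s)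
      atTop (𝓝 D)) :
    ∃ (σ' : S → A) (hσ' : Measurable σ'), (∀ s, E.backup (M.signal lam) v s (σ' s) = v s) ∧
      ∀ s, Tendsto (fun n => E.V (Policy.deterministic (σ n) (hσ n)) M.utility s) atTop
        (𝓝 (E.V (Policy.deterministic σ' hσ') M.utility s)) := by
  have hc := M.isSignal_utility
  set C : ℕ → S → ℝ := fun n => E.V (Policy.deterministic (σ n) (hσ n)) M.utility with hCdef
  have hCm : ∀ n, IsBddMeasurable (C n) := fun n => isBddMeasurable_V hc
  have hCb : ∀ n s, |C n s| ≤ 1 / (1 - E.discount) := fun n => abs_V_le hc M.abs_utility_le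
  choose D hD using hlim
  have hDm : IsBddMeasurable D :=
    ⟨measurable_of_tendsto_metrizable (fun n => (hCm n).measurable) (tendsto_pi_nhds.2 hD), _,
      fun s => le_of_tendsto (hD s).abs (Eventually.of_forall fun n => hCb n s)⟩
  -- the optimal values converge, because they are Lipschitz in the multiplier
  have hwv : ∀ n s, |w n s - v s| ≤ |l n - lam| / (1 - E.discount) := fun n s => by
    rw [abs_le]
    constructor
    · have := hv.sub_le (hw n) (M.isSignal_signal _) (M.isSignal_signal _) (δ := |l n - lam|)
        (fun s a s' => (le_abs_self _).trans
          ((M.abs_signal_sub_le _ _ s a s').trans_eq (abs_sub_comm _ _))) s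
      linarith
    · exact (hw n).sub_le hv (M.isSignal_signal _) (M.isSignal_signal _)
        (fun s a s' => (le_abs_self _).trans (M.abs_signal_sub_le _ _ s a s')) s
  have hl0 : Tendsto (fun n => |l n - lam| / (1 - E.discount)) atTop (𝓝 0) := by
    have := ((hl.sub_const lam).abs).div_const (1 - E.discount)
    simpa using this
  have hwlim : ∀ s, Tendsto (fun n => w n s) atTop (𝓝 (v s)) := fun s => by
    rw [tendsto_iff_dist_tendsto_zero]
    exact squeeze_zero (fun _ => dist_nonneg) (fun n => hwv n s) hl0
  obtain ⟨L, hL⟩ : ∃ L, ∀ n, |l n - lam| ≤ L := by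
    obtain ⟨L, hL⟩ := ((hl.sub_const lam).abs).bddAbove_range
    exact ⟨L, fun n => hL ⟨n, rfl⟩⟩
  obtain ⟨Bv, hBv⟩ := hv.isBddMeasurable.bounded
  obtain ⟨Bf, hBf⟩ := (M.isSignal_signal lam).bounded
  have hwb : ∀ n s, |w n s| ≤ Bv + L / (1 - E.discount) := fun n s => by
    have h1 := hwv n s
    have h2 : |l n - lam| / (1 - E.discount) ≤ L / (1 - E.discount) :=
      div_le_div_of_nonneg_right (hL n) E.one_sub_discount_pos.le
    have h3 : |w n s| ≤ |w n s - v s| + |v s| := by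
      simpa using abs_add_le (w n s - v s) (v s)
    linarith [hBv s]
  have hfb : ∀ n s a s', |M.signal (l n) s a s'| ≤ Bf + L := fun n s a s' => by
    have h1 := M.abs_signal_sub_le (l n) lam s a s'
    have h3 : |M.signal (l n) s a s'| ≤
        |M.signal (l n) s a s' - M.signal lam s a s'| + |M.signal lam s a s'| := by
      simpa using abs_add_le (M.signal (l n) s a s' - M.signal lam s a s') (M.signal lam s a s')
    linarith [hL n, hBf (s, a, s')]
  have hlimC := fun s a => tendsto_backup (E := E) (F := fun _ => M.utility) (u := C) (fun _ => hc)
    hCm (fun _ => M.abs_utility_le) hCb (fun _ _ _ => tendsto_const_nhds) hD s a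
  have hlimw := fun s a => tendsto_backup (E := E) (F := fun n => M.signal (l n)) (u := w)
    (fun n => M.isSignal_signal (l n)) (fun n => (hw n).isBddMeasurable) hfb hwb
    (fun s a s' => tendsto_const_nhds.add (hl.mul_const _)) hwlim s a
  have hex : ∀ s, ∃ a, E.backup M.utility D s a = D s ∧ E.backup (M.signal lam) v s a = v s := by
    intro s
    obtain ⟨a, ha⟩ := exists_frequently_of_finite fun n =>
      (⟨σ n s, by
        rw [hCdef]
        simp only
        rw [← Q_eq_backup hc, V, Policy.integral_deterministic], hmax n s⟩ :
        ∃ a, E.backup M.utility (C n) s a = C n s ∧ E.backup (M.signal (l n)) (w n) s a = w n s)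
    exact ⟨a,
      tendsto_nhds_unique_of_frequently_eq (hlimC s a) (hD s) (ha.mono fun _ h => h.1),
      tendsto_nhds_unique_of_frequently_eq (hlimw s a) (hwlim s) (ha.mono fun _ h => h.2)⟩
  obtain ⟨σ', hσ', hmax'⟩ := exists_measurable_selector (fun a =>
    (measurableSet_backup_eq (E := E) hc hDm a).inter
      (measurableSet_backup_eq (E := E) (M.isSignal_signal lam) hv.isBddMeasurable a)) hex
  refine ⟨σ', hσ', fun s => (hmax' s).2, ?_⟩
  have hVD : E.V (Policy.deterministic σ' hσ') M.utility = D :=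
    V_eq_of_bellman hc hDm fun s => by rw [Policy.integral_deterministic, (hmax' s).1]
  rw [hVD]
  exact hD

/-- One-sided optimality condition at a minimizer of the dual function.  The multiplier is perturbed
in the direction of `κ`: for `κ > 0` some maximizing policy is feasible, and for `κ < 0` some
maximizing policy has utility at most `τ`. -/
lemma IsDualOptimal.exists_selector {M : CMDP E} (h : M.IsDualOptimal τ s₀ lam)
    (hv : E.IsOptimalValue (M.signal lam) v) {κ : ℝ} (hκ : κ ≠ 0) (hκ' : 0 ≤ lam + κ) :
    ∃ (σ : S → A) (hσ : Measurable σ), (∀ s, E.backup (M.signal lam) v s (σ s) = v s) ∧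
      0 ≤ κ * (E.V (Policy.deterministic σ hσ) M.utility s₀ - τ) := by
  set e : ℕ → ℝ := fun n => 1 / ((n : ℝ) + 1) with he
  have he0 : ∀ n, 0 < e n := fun n => Nat.one_div_pos_of_nat
  have he1 : ∀ n, e n ≤ 1 := fun n => by
    rw [he]; simp only
    rw [div_le_one (by positivity)]
    linarith [(Nat.cast_nonneg n : (0 : ℝ) ≤ n)]
  have hes : ∀ n, e (n + 1) < e n := fun n => Nat.one_div_lt_one_div (Nat.lt_succ_self n)
  set l : ℕ → ℝ := fun n => lam + κ * e n with hldef
  have hl : Tendsto l atTop (𝓝 lam) := by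
    have := (tendsto_one_div_add_atTop_nhds_zero_nat (𝕜 := ℝ)).const_mul κ |>.const_add lam
    rwa [mul_zero, add_zero] at this
  have hl0 : ∀ n, 0 ≤ l n := fun n => by
    have : l n = (1 - e n) * lam + e n * (lam + κ) := by simp only [hldef]; ring
    rw [this]
    exact add_nonneg (mul_nonneg (sub_nonneg.2 (he1 n)) h.1) (mul_nonneg (he0 n).le hκ')
  choose w hw using fun n => exists_isOptimalValue E (M.isSignal_signal (l n))
  choose σ hσ hmax using fun n => (hw n).exists_selector (M.isSignal_signal (l n))
  have hV : ∀ n, E.V (Policy.deterministic (σ n) (hσ n)) (M.signal (l n)) = w n := fun n =>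
    (hw n).V_deterministic (M.isSignal_signal _) (hσ n) (hmax n)
  set C : ℕ → S → ℝ := fun n => E.V (Policy.deterministic (σ n) (hσ n)) M.utility with hC
  have hanti : ∀ s, Antitone fun n => κ * C n s := fun s => antitone_nat_of_succ_le fun n => by
    have h1 := M.mul_V_utility_sub_nonneg (hw n) (hw (n + 1)) (hV n) (hV (n + 1)) s
    have h2 : l (n + 1) - l n = -(κ * (e n - e (n + 1))) := by simp only [hldef]; ring
    rw [h2] at h1
    have h3 : 0 ≤ (e n - e (n + 1)) * (κ * C n s - κ * C (n + 1) s) := by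
      simp only [hC]; linarith
    linarith [nonneg_of_mul_nonneg_right h3 (sub_pos.2 (hes n))]
  have hlim : ∀ s, ∃ D, Tendsto (fun n => C n s) atTop (𝓝 D) := fun s => by
    have hb : BddBelow (Set.range fun n => κ * C n s) := by
      refine ⟨-(|κ| * (1 / (1 - E.discount))), ?_⟩
      rintro _ ⟨n, rfl⟩
      have h1 := abs_V_le (E := E) (π := Policy.deterministic (σ n) (hσ n)) M.isSignal_utility
        M.abs_utility_le s
      have h2 : |κ * C n s| ≤ |κ| * (1 / (1 - E.discount)) := by
        rw [abs_mul]
        exact mul_le_mul_of_nonneg_left h1 (abs_nonneg κ)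
      exact (abs_le.1 h2).1
    refine ⟨κ⁻¹ * _, ((tendsto_atTop_ciInf (hanti s) hb).const_mul κ⁻¹).congr fun n => ?_⟩
    rw [inv_mul_cancel_left₀ hκ]
  obtain ⟨σ', hσ', hmax', hlim'⟩ := M.exists_limit_selector hl hv hw hσ hmax hlim
  refine ⟨σ', hσ', hmax', ge_of_tendsto' (((hlim' s₀).sub_const τ).const_mul κ) fun n => ?_⟩
  have h1 := h.mul_sub_nonneg (hl0 n) (hw n) (hV n)
  have h2 : l n - lam = κ * e n := by simp only [hldef]; ring
  rw [h2] at h1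
  have h3 : 0 ≤ e n * (κ * (C n s₀ - τ)) := by simp only [hC]; linarith
  exact nonneg_of_mul_nonneg_right h3 (he0 n)

/-- Strong duality: some feasible policy maximizes the Lagrangian at the optimal multiplier in every
state, and satisfies complementary slackness. -/
theorem IsDualOptimal.exists_saddle {M : CMDP E} (h : M.IsDualOptimal τ s₀ lam)
    (hv : E.IsOptimalValue (M.signal lam) v) :
    ∃ π : Policy S A, E.V π (M.signal lam) = v ∧ τ ≤ E.V π M.utility s₀ ∧
      lam * (E.V π M.utility s₀ - τ) = 0 := by
  obtain ⟨σ₁, h₁, hmax₁, hτ₁⟩ := h.exists_selector hv one_ne_zero (by linarith [h.1])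
  rw [one_mul] at hτ₁
  rcases h.1.eq_or_lt with h0 | hpos
  · exact ⟨Policy.deterministic σ₁ h₁, hv.V_deterministic (M.isSignal_signal lam) h₁ hmax₁,
      by linarith, by rw [← h0, zero_mul]⟩
  obtain ⟨σ₂, h₂, hmax₂, hτ₂⟩ := h.exists_selector hv (neg_ne_zero.2 hpos.ne') (by simp)
  have hτ₂' : E.V (Policy.deterministic σ₂ h₂) M.utility s₀ ≤ τ := by
    have : 0 ≤ lam * (τ - E.V (Policy.deterministic σ₂ h₂) M.utility s₀) := by linarith
    linarith [nonneg_of_mul_nonneg_right this hpos]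
  have hmix0 : Policy.mix σ₁ σ₂ h₁ h₂ 0 = Policy.deterministic σ₂ h₂ :=
    Policy.ext_kernel fun s => by
      simp [Policy.mix, Policy.deterministic, Kernel.deterministic_apply]
  have hmix1 : Policy.mix σ₁ σ₂ h₁ h₂ 1 = Policy.deterministic σ₁ h₁ :=
    Policy.ext_kernel fun s => by
      simp [Policy.mix, Policy.deterministic, Kernel.deterministic_apply]
  obtain ⟨θ, hθ⟩ := intermediate_value_univ (0 : unitInterval) 1
    (continuous_V_mix (E := E) M.isSignal_utility h₁ h₂ s₀)
    (show τ ∈ Set.Icc _ _ by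
      simp only [hmix0, hmix1]
      exact ⟨hτ₂', by linarith⟩)
  simp only at hθ
  exact ⟨Policy.mix σ₁ σ₂ h₁ h₂ θ, hv.V_eq (M.isSignal_signal lam) fun s =>
    Policy.ae_mix (hmax₁ s) (hmax₂ s), hθ.ge, by rw [hθ, sub_self, mul_zero]⟩

end CMDP

/-! ### Occupancy measures -/

lemma IsBddMeasurable.integral_comp {X Y : Type*} [MeasurableSpace X] [MeasurableSpace Y]
    {g : Y → ℝ} (hg : IsBddMeasurable g) (κ : Kernel X Y) [IsMarkovKernel κ] (μ : Measure X)
    [IsFiniteMeasure μ] : ∫ y, g y ∂(κ ∘ₘ μ) = ∫ x, ∫ y, g y ∂(κ x) ∂μ := by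
  rw [← Measure.snd_compProd, Measure.snd, integral_map measurable_snd.aemeasurable
    hg.measurable.aestronglyMeasurable,
    Measure.integral_compProd ((hg.comp measurable_snd).integrable _)]

namespace Environment

variable {E : Environment S A} {π : Policy S A} {f : S → A → S → ℝ} {v : S → ℝ} {s₀ : S}

/-- The law of `(s_t, a_t)` when `π` is run from `s₀`. -/
def pairLaw (E : Environment S A) (π : Policy S A) (s₀ : S) (t : ℕ) : Measure (S × A) :=
  E.law π t ∘ₘ (π.kernel s₀).map (Prod.mk s₀)

instance pairLaw_isProbabilityMeasure (t : ℕ) : IsProbabilityMeasure (E.pairLaw π s₀ t) := by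
  have : IsProbabilityMeasure ((π.kernel s₀).map (Prod.mk s₀)) :=
    Measure.isProbabilityMeasure_map measurable_prodMk_left.aemeasurable
  unfold pairLaw
  infer_instance

lemma stateLaw_eq (t : ℕ) : E.stateLaw π s₀ t = (E.pairLaw π s₀ t).map Prod.fst := by
  rw [stateLaw, pairLaw, law, ← Measure.map_comp _ _ (measurable_pi_apply t),
    Measure.map_map measurable_fst (measurable_pi_apply t)]
  rfl

lemma pairLaw_zero : E.pairLaw π s₀ 0 = (π.kernel s₀).map (Prod.mk s₀) := by
  rw [pairLaw, law_zero, Measure.id_comp]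

lemma pairLaw_succ (t : ℕ) : E.pairLaw π s₀ (t + 1) = E.step π ∘ₘ E.pairLaw π s₀ t := by
  rw [pairLaw, law_succ, pairLaw, Measure.comp_assoc]

instance stateLaw_isProbabilityMeasure (t : ℕ) : IsProbabilityMeasure (E.stateLaw π s₀ t) := by
  rw [stateLaw_eq]
  exact Measure.isProbabilityMeasure_map measurable_fst.aemeasurable

instance occupancy_isFiniteMeasure : IsFiniteMeasure (E.occupancy π s₀) := by
  refine ⟨?_⟩
  rw [occupancy, Measure.sum_apply _ MeasurableSet.univ]
  simp only [Measure.smul_apply, measure_univ, smul_eq_mul, mul_one]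
  rw [← ENNReal.ofReal_tsum_of_nonneg (fun t => pow_nonneg E.discount_nonneg t)
    (summable_geometric_of_lt_one E.discount_nonneg E.discount_lt_one)]
  exact ENNReal.ofReal_lt_top

lemma integral_stateLaw_zero {g : S → ℝ} (hg : IsBddMeasurable g) :
    ∫ s, g s ∂(E.stateLaw π s₀ 0) = g s₀ := by
  rw [stateLaw_eq, pairLaw_zero, Measure.map_map measurable_fst measurable_prodMk_left,
    integral_map (measurable_fst.comp measurable_prodMk_left).aemeasurable
      hg.measurable.aestronglyMeasurable]
  simp

lemma integral_stateLaw_succ {g : S → ℝ} (hg : IsBddMeasurable g) (t : ℕ) :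
    ∫ s, g s ∂(E.stateLaw π s₀ (t + 1)) =
      ∫ z, (∫ s', g s' ∂(E.transition z)) ∂(E.pairLaw π s₀ t) := by
  have hg' : IsBddMeasurable fun z : S × A => g z.1 := hg.comp measurable_fst
  rw [stateLaw_eq, integral_map measurable_fst.aemeasurable hg.measurable.aestronglyMeasurable,
    pairLaw_succ, hg'.integral_comp]
  congr 1 with z
  rw [integral_step hg']
  simp

/-- If `π` attains the optimal value at `s₀`, then it does so at almost every state it visits.  The
loss at `s₀` dominates the discounted expected loss at any later time. -/
theorem IsOptimalValue.ae_occupancy (h : E.IsOptimalValue f v) (hf : IsSignal f)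
    (h₀ : E.V π f s₀ = v s₀) : ∀ᵐ s ∂(E.occupancy π s₀), E.V π f s = v s := by
  have hV := isBddMeasurable_V (E := E) (π := π) hf
  have hG : IsBddMeasurable fun s => v s - E.V π f s := h.isBddMeasurable.sub hV
  have hG0 : ∀ s, 0 ≤ v s - E.V π f s := fun s => sub_nonneg.2 (h.V_le hf π s)
  -- the loss caused after the first action, which is then chained over the steps of the trajectory
  set H : S × A → ℝ := fun z => E.backup f v z.1 z.2 - E.Q π f z.1 z.2 with hHdef
  have hH : IsBddMeasurable H :=
    (isBddMeasurable_backup hf h.isBddMeasurable).sub (isBddMeasurable_Q hf)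
  have hHG : ∀ z, H z = E.discount * ∫ s', (v s' - E.V π f s') ∂(E.transition z) := fun z => by
    simp only [hHdef]
    rw [Q_eq_backup hf, backup_eq hf h.isBddMeasurable, backup_eq hf hV,
      integral_sub (h.isBddMeasurable.integrable _) (hV.integrable _)]
    ring
  have hle : ∀ s, ∫ a, H (s, a) ∂(π.kernel s) ≤ v s - E.V π f s := fun s => by
    have h1 := (isBddMeasurable_backup (E := E) hf h.isBddMeasurable).section_right s
    have h2 := (isBddMeasurable_Q (E := E) (π := π) hf).section_right s
    have h3 := h1.integral_sub_le (IsBddMeasurable.const (v s)) (π.kernel s) (C := 0)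
      (ae_of_all _ fun a => by linarith [h.backup_le s a])
    simp only [hHdef]
    rw [integral_sub (h1.integrable _) (h2.integrable _)]
    simp only [integral_const, probReal_univ, one_smul] at h3
    simp only [V]
    linarith
  have hrec : ∀ t, E.discount * ∫ z, H z ∂(E.pairLaw π s₀ (t + 1)) ≤
      ∫ z, H z ∂(E.pairLaw π s₀ t) := fun t => by
    rw [pairLaw_succ, hH.integral_comp, ← integral_const_mul]
    have hstep : IsBddMeasurable fun z => ∫ y, H y ∂(E.step π z) :=
      (hH.comp (φ := fun w : (S × A) × (S × A) => w.2) measurable_snd).integral_kernel _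
    refine integral_mono ((hstep.const_mul _).integrable _) (hH.integrable _) fun z => ?_
    simp only
    rw [hHG z, integral_step hH]
    exact mul_le_mul_of_nonneg_left (integral_mono
      ((hH.integral_kernel π.kernel).integrable _) (hG.integrable _) hle) E.discount_nonneg
  have hpow : ∀ t, E.discount ^ t * ∫ z, H z ∂(E.pairLaw π s₀ t) ≤ 0 := by
    intro t
    induction t with
    | zero =>
      rw [pow_zero, one_mul, pairLaw_zero, integral_map measurable_prodMk_left.aemeasurable
        hH.measurable.aestronglyMeasurable]
      linarith [hle s₀]
    | succ t ih =>
      refine le_trans ?_ ih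
      rw [pow_succ, mul_assoc]
      exact mul_le_mul_of_nonneg_left (hrec t) (pow_nonneg E.discount_nonneg t)
  have hzero : ∀ t, E.discount ^ t * ∫ s, (v s - E.V π f s) ∂(E.stateLaw π s₀ t) ≤ 0 := by
    intro t
    cases t with
    | zero => rw [integral_stateLaw_zero hG, h₀]; simp
    | succ t =>
      rw [integral_stateLaw_succ hG, pow_succ, mul_assoc, ← integral_const_mul]
      simp_rw [← hHG]
      exact hpow t
  rw [occupancy, Measure.ae_sum_iff]
  intro t
  rcases (pow_nonneg E.discount_nonneg t).eq_or_lt with h0 | hpos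
  -- for `γ = 0` only the time `t = 0` contributes to the occupancy measure
  · rw [← h0, ENNReal.ofReal_zero, zero_smul]
    simp
  refine Measure.ae_smul_measure ?_ _
  have h1 : ∫ s, (v s - E.V π f s) ∂(E.stateLaw π s₀ t) = 0 :=
    le_antisymm (nonpos_of_mul_nonpos_right (hzero t) hpos) (integral_nonneg hG0)
  filter_upwards [(integral_eq_zero_iff_of_nonneg hG0 (hG.integrable _)).1 h1] with s hs
  simp only [Pi.zero_apply] at hs
  linarith

/-- Only the values at almost every next state enter the action values. -/
lemma Q_eq_backup_of_ae (hv : ∀ s a, ∀ᵐ s' ∂(E.transition (s, a)), E.V π f s' = v s')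
    (hf : IsSignal f) (s : S) (a : A) : E.Q π f s a = E.backup f v s a := by
  rw [Q_eq_backup hf, backup, backup]
  refine integral_congr_ae ?_
  filter_upwards [hv s a] with s' hs'
  rw [hs']

/-! ### Generalized policy improvement -/

/-- Generalized policy improvement: if `π` is greedy with respect to the maximum of approximations
`q i` of the action values of the policies `ρ i`, it is almost as good as each of them. -/
theorem Q_sub_le_of_isGreedy [MeasurableSingletonClass A] [Finite A] {ι : Type*} [Finite ι]
    (hf : IsSignal f) {ρ : ι → Policy S A} {q : ι → S → A → ℝ} {η : ℝ} (hη : 0 ≤ η)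
    (hq : ∀ i s a, |E.Q (ρ i) f s a - q i s a| ≤ η)
    (hπ : π.IsGreedy fun s a => ⨆ i, q i s a) (i : ι) (s : S) (a : A) :
    E.Q (ρ i) f s a - E.Q π f s a ≤ 2 * η / (1 - E.discount) := by
  have : Nonempty ι := ⟨i⟩
  have hbdd : ∀ s a, BddAbove (Set.range fun i => q i s a) := fun s a =>
    (Set.finite_range _).bddAbove
  have hb : BddAbove (Set.range fun x : ι × S × A =>
      E.Q (ρ x.1) f x.2.1 x.2.2 - E.Q π f x.2.1 x.2.2) := by
    obtain ⟨B, hB⟩ := hf.bounded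
    refine ⟨B / (1 - E.discount) + B / (1 - E.discount), ?_⟩
    rintro _ ⟨x, rfl⟩
    have h1 := abs_Q_le (E := E) (π := ρ x.1) hf (fun s a s' => hB (s, a, s')) x.2.1 x.2.2
    have h2 := abs_Q_le (E := E) (π := π) hf (fun s a s' => hB (s, a, s')) x.2.1 x.2.2
    linarith [(abs_le.1 h1).2, (abs_le.1 h2).1]
  refine (le_div_of_contraction (η := E.discount * (2 * η)) E.discount_lt_one hb
    (fun C hC x => ?_) (i, s, a)).trans ?_
  · -- each exchange of `q` for the true action values costs `η`
    have hV : ∀ i s, E.V (ρ i) f s - E.V π f s ≤ C + 2 * η := fun i s => by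
      have hπQ := (isBddMeasurable_Q (E := E) (π := π) hf).section_right s
      have hle : ∀ᵐ a ∂(π.kernel s), ∀ b, E.Q (ρ i) f s b ≤ E.Q π f s a + (C + 2 * η) := by
        filter_upwards [hπ s] with a ha b
        obtain ⟨k, hk⟩ := exists_eq_ciSup_of_finite (f := fun i => q i s a)
        have h1 := ha b
        rw [← hk] at h1
        linarith [le_ciSup (hbdd s b) i, (abs_le.1 (hq i s b)).2, (abs_le.1 (hq k s a)).1,
          hC (k, s, a)]
      have h1 : ∀ᵐ a ∂(π.kernel s), E.V (ρ i) f s - E.Q π f s a ≤ C + 2 * η := by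
        filter_upwards [hle] with a ha
        have := ((isBddMeasurable_Q (E := E) (π := ρ i) hf).section_right s).integral_sub_le
          (IsBddMeasurable.const (E.Q π f s a)) ((ρ i).kernel s) (C := C + 2 * η)
          (ae_of_all _ fun b => by linarith [ha b])
        simpa [V] using this
      have := (IsBddMeasurable.const (E.V (ρ i) f s)).integral_sub_le hπQ (π.kernel s) h1
      simpa [V] using this
    rw [Q_eq_backup hf, Q_eq_backup hf]
    have := backup_sub_le (E := E) hf hf (isBddMeasurable_V hf) (isBddMeasurable_V hf) (δ := 0)
      (s := x.2.1) (a := x.2.2) (hV x.1) (fun _ => by simp)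
    linarith
  · refine div_le_div_of_nonneg_right ?_ E.one_sub_discount_pos.le
    exact mul_le_of_le_one_left (by positivity) E.discount_lt_one.le

end Environment

/-! ### Optimal policies of the constrained problem -/

namespace CMDP

open Environment

variable {E : Environment S A} {M : CMDP E} {v : S → ℝ} {lam τ : ℝ} {s₀ : S} {π : Policy S A}

/-- A feasible policy that maximizes the Lagrangian at `s₀` and satisfies complementary slackness
solves the constrained problem. -/
lemma isOptimal_of_saddle (h0 : 0 ≤ lam) (hv : E.IsOptimalValue (M.signal lam) v)
    (hπ : E.V π (M.signal lam) s₀ = v s₀) (hfeas : τ ≤ E.V π M.utility s₀)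
    (hslack : lam * (E.V π M.utility s₀ - τ) = 0) : M.IsOptimal τ s₀ π := by
  refine ⟨hfeas, fun π' hπ' => ?_⟩
  have h1 := hv.V_le (M.isSignal_signal lam) π' s₀
  rw [← hπ, V_signal, V_signal] at h1
  have h2 := mul_le_mul_of_nonneg_left hπ' h0
  linarith

variable [MeasurableSingletonClass A] [Finite A] [Nonempty A]

/-- A policy that maximizes the Lagrangian in every state does so off its path in particular, whence
the existence of an optimal policy with this additional property. -/
lemma IsDualOptimal.exists_isOptimal (h : M.IsDualOptimal τ s₀ lam) :
    ∃ π : Policy S A, M.IsOptimal τ s₀ π ∧ M.IsOptimalOffPath τ s₀ lam π := by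
  obtain ⟨v, hv⟩ := exists_isOptimalValue E (M.isSignal_signal lam)
  obtain ⟨π, hπ, hfeas, hslack⟩ := h.exists_saddle hv
  refine ⟨π, isOptimal_of_saddle h.1 hv (by rw [hπ]) hfeas hslack, fun s a =>
    ae_of_all _ fun s' π' => ?_⟩
  rw [lagrangian_eq, lagrangian_eq, hπ]
  exact sub_le_sub_right (hv.V_le (M.isSignal_signal lam) π' s') _

/-- Every optimal policy of the constrained problem maximizes the Lagrangian at `s₀`. -/
lemma IsOptimal.V_signal_eq (hπ : M.IsOptimal τ s₀ π) (h : M.IsDualOptimal τ s₀ lam)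
    (hv : E.IsOptimalValue (M.signal lam) v) : E.V π (M.signal lam) s₀ = v s₀ := by
  obtain ⟨ρ, hρ, hfeas, hslack⟩ := h.exists_saddle hv
  refine le_antisymm (hv.V_le (M.isSignal_signal lam) π s₀) ?_
  rw [← hρ, V_signal, V_signal]
  linarith [hπ.2 ρ hfeas, mul_le_mul_of_nonneg_left hπ.1 h.1]

/-- An optimal policy that maximizes the Lagrangian off its path has the largest possible action
values for the Lagrangian signal. -/
theorem IsOptimal.Q_signal_eq (hπ : M.IsOptimal τ s₀ π) (hoff : M.IsOptimalOffPath τ s₀ lam π)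
    (h : M.IsDualOptimal τ s₀ lam) (hv : E.IsOptimalValue (M.signal lam) v) (s : S) (a : A) :
    E.Q π (M.signal lam) s a = E.backup (M.signal lam) v s a := by
  have hf := M.isSignal_signal lam
  obtain ⟨σ, hσ, hmax⟩ := hv.exists_selector hf
  refine Q_eq_backup_of_ae (fun s a => ?_) hf s a
  rw [← Measure.singularPart_add_rnDeriv (E.transition (s, a)) (E.occupancy π s₀),
    ae_add_measure_iff]
  constructor
  · filter_upwards [hoff s a] with s' hs'
    have := hs' (Policy.deterministic σ hσ)
    rw [lagrangian_eq, lagrangian_eq, hv.V_deterministic hf hσ hmax] at this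
    exact le_antisymm (hv.V_le hf π s') (by linarith)
  · exact (withDensity_absolutelyContinuous _ _).ae_le
      (hv.ae_occupancy hf (hπ.V_signal_eq h hv))

end CMDP

/-! ### Linear tasks -/

section Features

variable {E : Environment S A}

/-- Lagrangian signals of two linear tasks differ at most as much as their weights do. -/
lemma CMDP.IsLinear.abs_signal_sub_le {d : ℕ} {φ : S → A → S → EuclideanSpace ℝ (Fin d)}
    {M M' : CMDP E} {wr wc wr' wc' : EuclideanSpace ℝ (Fin d)} (h : M.IsLinear φ wr wc)
    (h' : M'.IsLinear φ wr' wc') (lam lam' : ℝ) {B : ℝ} (hB : ∀ s a s', ‖φ s a s'‖ ≤ B)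
    (s : S) (a : A) (s' : S) :
    |M.signal lam s a s' - M'.signal lam' s a s'| ≤
      B * ‖wr - wr'‖ + B * ‖lam • wc - lam' • wc'‖ := by
  have heq : M.signal lam s a s' - M'.signal lam' s a s' =
      inner ℝ (φ s a s') (wr - wr') + inner ℝ (φ s a s') (lam • wc - lam' • wc') := by
    simp only [CMDP.signal, h.1, h.2, h'.1, h'.2, inner_sub_right, inner_smul_right]
    ring
  rw [heq]
  refine (abs_add_le _ _).trans (add_le_add ?_ ?_) <;>
    exact (abs_real_inner_le_norm _ _).trans
      (mul_le_mul_of_nonneg_right (hB s a s') (norm_nonneg _))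

end Features

end

theorem proposition1
    {S A : Type*} [MeasurableSpace S] [MeasurableSpace A] [MeasurableSingletonClass A]
    [Finite A] [Nonempty A]
    (E : Environment S A) (s₀ : S)
    (τ : ℝ) (hτ₀ : 0 < τ) (hτ₁ : τ ≤ 1 / (1 - E.discount))
    {d : ℕ} (φ : S → A → S → EuclideanSpace ℝ (Fin d))
    (hφ : ∃ B : ℝ, ∀ s a s', ‖φ s a s'‖ ≤ B)
    {N : ℕ} [NeZero N]
    -- source tasks `M i` and target task `Mj`, with their weights
    (M : Fin N → CMDP E) (wr wc : Fin N → EuclideanSpace ℝ (Fin d))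
    (hM : ∀ i, (M i).IsLinear φ (wr i) (wc i))
    (Mj : CMDP E) (wrj wcj : EuclideanSpace ℝ (Fin d)) (hMj : Mj.IsLinear φ wrj wcj)
    (hSlater : ∀ i, (M i).Slater τ s₀) (hSlaterj : Mj.Slater τ s₀)
    -- optimal dual variables
    (lam : Fin N → ℝ) (hlam : ∀ i, (M i).IsDualOptimal τ s₀ (lam i))
    (lamj : ℝ) (hlamj : Mj.IsDualOptimal τ s₀ lamj) :
    -- the optimal policies in question exist
    (∀ i, ∃ π : Policy S A,
      (M i).IsOptimal τ s₀ π ∧ (M i).IsOptimalOffPath τ s₀ (lam i) π) ∧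
    (∃ π : Policy S A, Mj.IsOptimal τ s₀ π) ∧
    -- and for every choice of them the bound holds
    ∀ (πs : Fin N → Policy S A) (πj : Policy S A),
      (∀ i, (M i).IsOptimal τ s₀ (πs i)) →
      (∀ i, (M i).IsOptimalOffPath τ s₀ (lam i) (πs i)) →
      Mj.IsOptimal τ s₀ πj →
      ∀ (Qr Qc : Fin N → S → A → ℝ) (ε : ℝ),
        (∀ i s a, |E.Q (πs i) Mj.reward s a - Qr i s a| ≤ ε) →
        (∀ i s a, |E.Q (πs i) Mj.utility s a - Qc i s a| ≤ ε) →
        ∀ lamt : ℝ, 0 ≤ lamt →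
          ∀ π : Policy S A,
            π.IsGreedy (fun s a => ⨆ i, (Qr i s a + lamt * Qc i s a)) →
            ∀ s a,
              Mj.lagrangianQ τ πj lamj s a - Mj.lagrangianQ τ π lamt s a ≤
                ⨅ i, (2 / (1 - E.discount) *
                    ((⨆ x : S × A × S, ‖φ x.1 x.2.1 x.2.2‖) * ‖wrj - wr i‖
                      + (⨆ x : S × A × S, ‖φ x.1 x.2.1 x.2.2‖) * ‖lamj • wcj - lam i • wc i‖
                      + |lamj - lamt| + ε * (1 + lamt))
                  + 2 * τ * |lamj - lam i|) := by
  refine ⟨fun i => (hlam i).exists_isOptimal, ?_, ?_⟩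
  · obtain ⟨π, hπ, -⟩ := hlamj.exists_isOptimal
    exact ⟨π, hπ⟩
  intro πs πj hπs hoff hπj Qr Qc ε hQr hQc lamt hlamt π hgreedy s a
  refine le_ciInf fun i => ?_
  have hγ := E.one_sub_discount_pos
  have hε : 0 ≤ ε := (abs_nonneg _).trans (hQr i s a)
  set Φ : ℝ := ⨆ x : S × A × S, ‖φ x.1 x.2.1 x.2.2‖ with hΦ
  have hφΦ : ∀ s a s', ‖φ s a s'‖ ≤ Φ := fun s a s' => by
    obtain ⟨B, hB⟩ := hφ
    exact le_ciSup (f := fun x : S × A × S => ‖φ x.1 x.2.1 x.2.2‖)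
      ⟨B, by rintro _ ⟨x, rfl⟩; exact hB _ _ _⟩ (s, a, s')
  set Δ : ℝ := Φ * ‖wrj - wr i‖ + Φ * ‖lamj • wcj - lam i • wc i‖ with hΔ
  have hji : ∀ s a s', |Mj.signal lamj s a s' - (M i).signal (lam i) s a s'| ≤ Δ :=
    hMj.abs_signal_sub_le (hM i) lamj (lam i) hφΦ
  have hfj := Mj.isSignal_signal lamj
  have hfi := (M i).isSignal_signal (lam i)
  have hft := Mj.isSignal_signal lamt
  -- replace the target signal by the source signal, for which `πs i` is optimal everywhere
  have e1 := Environment.Q_sub_le (E := E) (π := πj) hfj hfi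
    (fun s a s' => (le_abs_self _).trans (hji s a s')) s a
  have e2 : E.Q πj ((M i).signal (lam i)) s a ≤ E.Q (πs i) ((M i).signal (lam i)) s a := by
    obtain ⟨v, hv⟩ := Environment.exists_isOptimalValue E hfi
    rw [(hπs i).Q_signal_eq (hoff i) (hlam i) hv]
    exact hv.Q_le hfi πj s a
  have e3 := Environment.Q_sub_le (E := E) (π := πs i) hfi hfj
    (fun s a s' => (le_abs_self _).trans ((abs_sub_comm _ _).trans_le (hji s a s'))) s a
  -- change the multiplier
  have e4 := Environment.Q_sub_le (E := E) (π := πs i) hfj hft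
    (fun s a s' => (le_abs_self _).trans (Mj.abs_signal_sub_le lamj lamt s a s')) s a
  have e5 := Environment.Q_sub_le_of_isGreedy (E := E) (π := π) hft (ρ := πs)
    (q := fun i s a => Qr i s a + lamt * Qc i s a) (η := ε * (1 + lamt)) (by positivity)
    (fun i s a => by
      have h : E.Q (πs i) (Mj.signal lamt) s a =
          E.Q (πs i) Mj.reward s a + lamt * E.Q (πs i) Mj.utility s a :=
        Environment.Q_add_mul Mj.isSignal_reward Mj.isSignal_utility lamt s a
      have h' : E.Q (πs i) (Mj.signal lamt) s a - (Qr i s a + lamt * Qc i s a) =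
          (E.Q (πs i) Mj.reward s a - Qr i s a) +
            lamt * (E.Q (πs i) Mj.utility s a - Qc i s a) := by
        rw [h]; ring
      rw [h']
      refine (abs_add_le _ _).trans ?_
      rw [abs_mul, abs_of_nonneg hlamt]
      linarith [hQr i s a, mul_le_mul_of_nonneg_left (hQc i s a) hlamt]) hgreedy i s a
  have e6 : (lamt - lamj) * τ ≤ |lamj - lamt| / (1 - E.discount) := by
    rw [div_eq_mul_one_div, abs_sub_comm]
    exact mul_le_mul (le_abs_self _) hτ₁ hτ₀.le (abs_nonneg _)
  -- the summand `2 τ |λ_j - λ_i|` of the bound enters only through its sign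
  have e7 : 0 ≤ 2 * τ * |lamj - lam i| := by positivity
  have e8 : 2 / (1 - E.discount) * (Δ + |lamj - lamt| + ε * (1 + lamt)) =
      Δ / (1 - E.discount) + Δ / (1 - E.discount) + |lamj - lamt| / (1 - E.discount) +
        |lamj - lamt| / (1 - E.discount) + 2 * (ε * (1 + lamt)) / (1 - E.discount) := by
    ring
  rw [Mj.lagrangianQ_eq, Mj.lagrangianQ_eq, e8]
  linarith
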